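/- Let $u_1,\dots,u_M$ be the standard basis of $\mathbb R^M$. For a set $E$ of axes (basis vectors) let $\mathbb R(E)$ be its span and $\mathcal O(E)=\{\sum_{u\in E}\lambda_u u\mid \lambda_u>0\}$ the open positive orthant on $E$ (so $\mathcal O(\emptyset)=\{0\}$). Let $\boldsymbol X^m\subseteq\mathbb R^M$ be an orthant space of dimension $m$: a union of open positive orthants whose maximum dimension is $m$, such that (i) with every orthant $\mathcal O(E)\subseteq\boldsymbol X^m$ all the orthants $\mathcal O(F)$, $F\subseteq E$, in its closure lie in $\boldsymbol X^m$, and (ii) whenever all the two-dimensional orthants in the closure of an orthant $\mathcal O(E)$, $|E|\geqslant 2$, lie in $\boldsymbol X^m$, so does $\mathcal O(E)$. It carries the intrinsic metric $d$: $d(y,z)$ is the infimum of the lengths of the piecewise linear paths in $\boldsymbol X^m$ from $y$ to $z$. Geodesics are parametrised on $[0,1]$ proportionally to arc length. For $y\in\boldsymbol X^m$ let $E(y)$ be the set of axes along which $y$ has a positive coordinate, and call $E$ and $F$ compatible if $\mathcal O(E\cup F)\subseteq\boldsymbol X^m$. Put $$E(y,z)=\{E(y)\cap E(z)\}\cup\{e\in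 E(y)\mid e\text{ compatible with }E(z)\}\cup\{e\in E(z)\mid e\text{ compatible with }E(y)\}.$$ The support of the geodesic $\gamma$ from $y$ to $z$ is the pair of sequences $(A_0,\dots,A_k)$, $(B_0,\dots,B_k)$ of sets of axes with $A_0=B_0=E(y,z)$, with $A_0,A_1,\dots,A_k,B_1,\dots,B_k$ mutually disjoint, and such that the carrier of $\gamma$, that is, the sequence of the distinct strata that $\gamma$ traverses successively during time intervals of positive length, is $\mathcal O(A_0\cup B_1\cup\cdots\cup B_i\cup A_{i+1}\cup\cdots\cup A_k)$, $i=0,1,\dots,k$. The logarithm $\log_{y}(z)\in\mathbb R^M$ is the initial tangent vector (one-sided derivative at $0$), with norm $d(y,z)$, of the geodesic from $y$ to $z$, and the translated logarithm map is $\Phi(z;y)=\log_y(z)+y$. Let $P_E(y)\in\mathbb R(E)$ be the coordinate vector of the orthogonal projection of $y$ to $\mathbb R(E)$, and let $\jmath$ denote the linear map that puts the coordinates of a vector $(w_0,\dots,w_k)$ of blocks $w_i\in\mathbb R(E_i)$, for disjoint sets $E_i$ of axes, at their places in $\mathbb R^M$, with zeros elsewhere. **Theorem.** Let $x^*$ and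 $x$ be any two points of $\boldsymbol X^m$, with $x^*$ in a stratum of any co-dimension, and let $(A_0,\dots,A_k)$, $(B_0,\dots,B_k)$ be the support of the geodesic $\gamma$ from $x^*$ to $x$. Then $\gamma$ has the initial tangent vector $\log_{x^*}(x)$, of norm $d(x^*,x)$, the numbers $\|P_{A_i}(x^*)\|$, $1\leqslant i\leqslant k$, are non-zero, and $$\Phi(x;x^*)=\jmath\left(P_{B_0}(x),\,-\frac{\|P_{B_1}(x)\|}{\|P_{A_1}(x^*)\|}P_{A_1}(x^*),\,\dots,\,-\frac{\|P_{B_k}(x)\|}{\|P_{A_k}(x^*)\|}P_{A_k}(x^*)\right).$$ -/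

import Mathlib

noncomputable section

namespace Orthant

/-- The ambient Euclidean space `ℝ^M`; its standard basis is indexed by `Fin M`, and a set of axes
is a `Finset (Fin M)`. -/
abbrev Space (M : ℕ) : Type := EuclideanSpace ℝ (Fin M)

/-- The open positive orthant `𝒪(E)`: coordinates in `E` are positive, all others vanish. -/
def orthant {M : ℕ} (E : Finset (Fin M)) : Set (Space M) :=
  {x | (∀ i ∈ E, 0 < x i) ∧ ∀ i ∉ E, x i = 0}

/-- `X ⊆ ℝ^M` is an orthant space of dimension `m`. -/
structure IsOrthantSpace {M : ℕ} (m : ℕ) (X : Set (Space M)) : Prop where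
  /-- `X` is a union of open positive orthants. -/
  union : ∃ S : Set (Finset (Fin M)), X = ⋃ E ∈ S, orthant E
  /-- The maximum dimension of the orthants in `X` is `m`. -/
  dim : IsGreatest {n : ℕ | ∃ E : Finset (Fin M), orthant E ⊆ X ∧ E.card = n} m
  /-- The orthants in the closure of an orthant in `X` are in `X`. -/
  face : ∀ E F : Finset (Fin M), F ⊆ E → orthant E ⊆ X → orthant F ⊆ X
  /-- If all two-dimensional orthants in the closure of an orthant are in `X`, so is the orthant. -/
  flag : ∀ E : Finset (Fin M), 2 ≤ E.card →
    (∀ F ⊆ E, F.card = 2 → orthant F ⊆ X) → orthant E ⊆ X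

/-- `L` is the length of a piecewise linear path in `X` from `x` to `y`. -/
def IsPathLength {M : ℕ} (X : Set (Space M)) (x y : Space M) (L : ℝ) : Prop :=
  ∃ (n : ℕ) (p : ℕ → Space M), p 0 = x ∧ p n = y ∧
    (∀ i < n, segment ℝ (p i) (p (i + 1)) ⊆ X) ∧
    L = ∑ i ∈ Finset.range n, ‖p (i + 1) - p i‖

/-- The intrinsic metric of `X`: infimum of the lengths of piecewise linear paths in `X`. -/
def intrinsicDist {M : ℕ} (X : Set (Space M)) (x y : Space M) : ℝ :=
  sInf {L : ℝ | IsPathLength X x y L}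

/-- `γ` restricted to `[0,1]` is a geodesic of `X` from `x` to `y` for the intrinsic metric,
parametrised proportionally to arc length. -/
structure IsGeodesic {M : ℕ} (X : Set (Space M)) (x y : Space M) (γ : ℝ → Space M) : Prop where
  source : γ 0 = x
  target : γ 1 = y
  mem : ∀ t ∈ Set.Icc (0 : ℝ) 1, γ t ∈ X
  dist_eq : ∀ s ∈ Set.Icc (0 : ℝ) 1, ∀ t ∈ Set.Icc (0 : ℝ) 1,
    intrinsicDist X (γ s) (γ t) = |s - t| * intrinsicDist X x y

/-- `E(x)`: the axes along which `x` has a positive coordinate. -/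
def posAxes {M : ℕ} (x : Space M) : Finset (Fin M) :=
  Finset.univ.filter fun i => 0 < x i

/-- `E` and `F` are compatible in `X`. -/
def Compatible {M : ℕ} (X : Set (Space M)) (E F : Finset (Fin M)) : Prop :=
  orthant (E ∪ F) ⊆ X

open Classical in
/-- `E(x,y)`: the common axes of `x` and `y`, the axes of `x` compatible with those of `y`, and
the axes of `y` compatible with those of `x`. -/
def commonAxes {M : ℕ} (X : Set (Space M)) (x y : Space M) : Finset (Fin M) :=
  (posAxes x ∩ posAxes y)
    ∪ (posAxes x).filter (fun e => Compatible X {e} (posAxes y))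
    ∪ (posAxes y).filter (fun e => Compatible X {e} (posAxes x))

/-- The carrier of the path `γ : [0,1] → ℝ^M` is the sequence `𝒪(O 0), …, 𝒪(O k)`: up to finitely
many instants, `γ` runs successively through these strata, each during an interval of positive
length, and consecutive strata differ. A constant path has the one stratum in which it stays. -/
def IsCarrier {M k : ℕ} (γ : ℝ → Space M) (O : Fin (k + 1) → Finset (Fin M)) : Prop :=
  (∃ s : Fin (k + 2) → ℝ, StrictMono s ∧ s 0 = 0 ∧ s (Fin.last (k + 1)) = 1 ∧
    ∀ i : Fin (k + 1), ∀ t ∈ Set.Ioo (s i.castSucc) (s i.succ), γ t ∈ orthant (O i)) ∧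
  ∀ i : Fin k, O i.castSucc ≠ O i.succ

/-- The axes `A_0 ∪ B_1 ∪ ⋯ ∪ B_i ∪ A_{i+1} ∪ ⋯ ∪ A_k`. -/
def carrierAxes {M k : ℕ} (A B : Fin (k + 1) → Finset (Fin M)) (i : Fin (k + 1)) :
    Finset (Fin M) :=
  A 0 ∪ (Finset.univ.filter fun j => 0 < j ∧ j ≤ i).biUnion B
    ∪ (Finset.univ.filter fun j => i < j).biUnion A

/-- `(A_0,…,A_k)`, `(B_0,…,B_k)` form the support of the geodesic `γ` from `x` to `y` in `X`:
`A_0 = B_0 = E(x,y)`, the unions of axes are disjoint, and the carrier of `γ` consists of the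
`𝒪(A_0 ∪ B_1 ∪ ⋯ ∪ B_i ∪ A_{i+1} ∪ ⋯ ∪ A_k)`, `i = 0,…,k`. (So, on passing to the `i`-th stratum,
`A_i` is the set of axes that are lost and `B_i` the set of axes that are gained.) -/
structure IsSupport {M k : ℕ} (X : Set (Space M)) (x y : Space M) (γ : ℝ → Space M)
    (A B : Fin (k + 1) → Finset (Fin M)) : Prop where
  A_zero : A 0 = commonAxes X x y
  B_zero : B 0 = commonAxes X x y
  disjoint_A : ∀ i j, i ≠ j → Disjoint (A i) (A j)
  disjoint_B : ∀ i j, i ≠ j → Disjoint (B i) (B j)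
  disjoint_AB : ∀ i j, i ≠ 0 → j ≠ 0 → Disjoint (A i) (B j)
  carrier : IsCarrier γ (carrierAxes A B)

/-- `v` is the initial tangent vector, of norm `d(x,y)`, of a geodesic of `X` from `x` to `y`. -/
def IsLog {M : ℕ} (X : Set (Space M)) (x y v : Space M) : Prop :=
  ∃ γ : ℝ → Space M, IsGeodesic X x y γ ∧
    HasDerivWithinAt γ v (Set.Icc 0 1) 0 ∧ ‖v‖ = intrinsicDist X x y

/-- The logarithm map `log_x(y)` of `X`, as a vector in `ℝ^M`. -/
def logMap {M : ℕ} (X : Set (Space M)) (x y : Space M) : Space M :=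
  Classical.epsilon (IsLog X x y)

/-- The translated logarithm map `Φ(y; x) = log_x(y) + x`. -/
def translatedLog {M : ℕ} (X : Set (Space M)) (y x : Space M) : Space M :=
  logMap X x y + x

/-- `P_E(x)`: the coordinate vector in `ℝ(E)` of the components of `x` along the axes in `E`. -/
def proj {M : ℕ} (E : Finset (Fin M)) (x : Space M) : EuclideanSpace ℝ E :=
  WithLp.toLp 2 fun e => x e

/-- The coordinates of a vector in `ℝ(E)` put at their places in `ℝ^M`, with zeros elsewhere. -/
def place {M : ℕ} (E : Finset (Fin M)) (w : EuclideanSpace ℝ E) : Space M :=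
  WithLp.toLp 2 fun e => if h : e ∈ E then w ⟨e, h⟩ else 0

/-- `ȷ(w_0, w_1, …, w_k)` for `w_0 ∈ ℝ(E_0)` and `w_i ∈ ℝ(E i)`, `i = 1,…,k`: every block of
coordinates is put at its place in `ℝ^M`, with zeros elsewhere. -/
def jmath {M k : ℕ} (E₀ : Finset (Fin M)) (E : Fin k → Finset (Fin M))
    (w₀ : EuclideanSpace ℝ E₀) (w : ∀ i, EuclideanSpace ℝ (E i)) : Space M :=
  place E₀ w₀ + ∑ i, place (E i) (w i)

end Orthant

end

/-! ### Orthant spaces, the intrinsic metric and partitions of the unit interval. -/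

namespace Orthant

variable {M : ℕ}

/-! The geodesic is identified by comparing energies coordinate by coordinate. An axis of the source
is lost if it is incompatible with some axis of the target, and gained axes are defined
symmetrically. If every lost axis reaches zero before the gained axes incompatible with it become
positive, the flag condition keeps the path inside `X`. Hence `profile`, which moves each coordinate
linearly over its own time interval, lies in `X` for every admissible choice of intervals, and
Cauchy–Schwarz bounds the squared distance by its energy (`sq_intrinsicDist_le`).

Conversely, given a geodesic, take as endpoints the first zero of each lost coordinate and the last
zero of each gained one (`exists_isSchedule`). The geodesic agrees with the corresponding profile at
these endpoints, so the cross term in the energy of their difference telescopes to the energy of the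
profile. The difference then has energy at most the squared distance minus the energy of the
profile, which is at most zero: the geodesic is the profile, and its energy is minimal
(`eq_profile`). Strict convexity of the energy in the interval lengths gives uniqueness (`eqOn`), so
the logarithm is the initial velocity of the profile.

The support says that the axes in `A j` vanish, and those in `B j` appear, at one common time `τ`
(`exists_times`). Moving `τ` slightly keeps the profile admissible, so `τ` minimises `a² / τ + b² /
(1 - τ)` locally, where `a` and `b` are the norms of the two projections. Therefore `a (1 - τ) = b
τ` (`norm_proj_balance`). A lost coordinate `c` has initial velocity `-c / τ`, and `-c / τ + c = -(b
/ a) c` is the asserted formula. -/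

lemma mem_posAxes {x : Space M} {e : Fin M} : e ∈ posAxes x ↔ 0 < x e := by
  simp [posAxes]

lemma mem_orthant_posAxes {x : Space M} (hx : ∀ e, 0 ≤ x e) : x ∈ orthant (posAxes x) := by
  refine ⟨fun i hi => by simpa [posAxes] using hi, fun i hi => ?_⟩
  have : ¬ 0 < x i := by simpa [posAxes] using hi
  exact le_antisymm (not_lt.1 this) (hx i)

lemma posAxes_eq_of_mem_orthant {E : Finset (Fin M)} {x : Space M} (h : x ∈ orthant E) :
    posAxes x = E := by
  ext i
  by_cases hi : i ∈ E
  · simp [posAxes, hi, h.1 i hi]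
  · simp [posAxes, hi, h.2 i hi]

lemma nonneg_of_mem_orthant {E : Finset (Fin M)} {x : Space M} (h : x ∈ orthant E) (e : Fin M) :
    0 ≤ x e := by
  by_cases he : e ∈ E
  · exact (h.1 e he).le
  · exact (h.2 e he).ge

namespace IsOrthantSpace

variable {m : ℕ} {X : Set (Space M)}

lemma exists_orthant (hX : IsOrthantSpace m X) {x : Space M} (hx : x ∈ X) :
    ∃ E, x ∈ orthant E ∧ orthant E ⊆ X := by
  obtain ⟨S, rfl⟩ := hX.union
  obtain ⟨E, hE, hxE⟩ := Set.mem_iUnion₂.1 hx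
  exact ⟨E, hxE, Set.subset_biUnion_of_mem (u := fun E => orthant E) hE⟩

lemma nonneg (hX : IsOrthantSpace m X) {x : Space M} (hx : x ∈ X) (e : Fin M) : 0 ≤ x e := by
  obtain ⟨E, hE, -⟩ := hX.exists_orthant hx
  exact nonneg_of_mem_orthant hE e

lemma orthant_posAxes_subset (hX : IsOrthantSpace m X) {x : Space M} (hx : x ∈ X) :
    orthant (posAxes x) ⊆ X := by
  obtain ⟨E, hE, h⟩ := hX.exists_orthant hx
  rwa [posAxes_eq_of_mem_orthant hE]

lemma orthant_pair_subset (hX : IsOrthantSpace m X) {x : Space M} (hx : x ∈ X) {e f : Fin M}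
    (he : 0 < x e) (hf : 0 < x f) : orthant {e, f} ⊆ X := by
  refine hX.face _ _ ?_ (hX.orthant_posAxes_subset hx)
  intro i hi
  rcases Finset.mem_insert.1 hi with rfl | hi
  · simpa [posAxes] using he
  · rw [Finset.mem_singleton.1 hi]
    simpa [posAxes] using hf

lemma orthant_empty_subset (hX : IsOrthantSpace m X) : orthant (∅ : Finset (Fin M)) ⊆ X := by
  obtain ⟨E, hE, -⟩ := hX.dim.1
  exact hX.face _ _ (Finset.empty_subset _) hE

/-- The flag condition says nothing below dimension two; allowing `e = f` in the hypothesis covers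
the one-dimensional case. -/
lemma orthant_subset_of_pairwise (hX : IsOrthantSpace m X) {E : Finset (Fin M)}
    (h : ∀ e ∈ E, ∀ f ∈ E, orthant {e, f} ⊆ X) : orthant E ⊆ X := by
  rcases lt_or_ge E.card 2 with hc | hc
  · rcases E.eq_empty_or_nonempty with rfl | ⟨e, he⟩
    · exact hX.orthant_empty_subset
    · have : E = {e} := by
        refine Finset.eq_singleton_iff_unique_mem.2 ⟨he, fun f hf => ?_⟩
        exact Finset.card_le_one.1 (by omega) f hf e he
      have h' := h e he e he
      rw [this]
      simpa using h'
  · refine hX.flag E hc fun F hF hF2 => ?_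
    obtain ⟨e, f, -, rfl⟩ := Finset.card_eq_two.1 hF2
    exact h e (hF (by simp)) f (hF (by simp))

lemma mem_of_pairwise (hX : IsOrthantSpace m X) {x : Space M} (h0 : ∀ e, 0 ≤ x e)
    (h : ∀ e f, 0 < x e → 0 < x f → orthant {e, f} ⊆ X) : x ∈ X := by
  refine hX.orthant_subset_of_pairwise (E := posAxes x) ?_ (mem_orthant_posAxes h0)
  intro e he f hf
  exact h e f (by simpa [posAxes] using he) (by simpa [posAxes] using hf)

lemma smul_mem (hX : IsOrthantSpace m X) {x : Space M} (hx : x ∈ X) {c : ℝ} (hc : 0 ≤ c) :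
    c • x ∈ X := by
  refine hX.mem_of_pairwise (fun e => ?_) fun e f he hf => ?_
  · simpa using mul_nonneg hc (hX.nonneg hx e)
  · simp only [PiLp.smul_apply, smul_eq_mul] at he hf
    exact hX.orthant_pair_subset hx (pos_of_mul_pos_right he hc) (pos_of_mul_pos_right hf hc)

/-- `X` is a cone, so two points can be joined through the origin. This makes the infimum defining
the metric one over a nonempty set, as lower bounds for `sInf` require. -/
lemma exists_isPathLength (hX : IsOrthantSpace m X) {x y : Space M} (hx : x ∈ X) (hy : y ∈ X) :
    ∃ L, IsPathLength X x y L := by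
  refine ⟨_, 2, fun i => if i = 0 then x else if i = 1 then 0 else y, by simp, by simp, ?_, rfl⟩
  intro i hi
  interval_cases i
  · simp only [if_true, zero_add, one_ne_zero, if_false]
    rw [segment_eq_image]
    rintro _ ⟨t, ht, rfl⟩
    simpa using hX.smul_mem hx (sub_nonneg.2 ht.2)
  · norm_num
    rw [segment_eq_image]
    rintro _ ⟨t, ht, rfl⟩
    simpa using hX.smul_mem hy ht.1

end IsOrthantSpace

variable {X : Set (Space M)} {x y : Space M}

lemma IsPathLength.norm_sub_le {L : ℝ} (h : IsPathLength X x y L) : ‖x - y‖ ≤ L := by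
  obtain ⟨n, p, rfl, rfl, -, rfl⟩ := h
  rw [norm_sub_rev, ← Finset.sum_range_sub]
  exact norm_sum_le _ _

lemma intrinsicDist_le {L : ℝ} (h : IsPathLength X x y L) : intrinsicDist X x y ≤ L :=
  csInf_le ⟨‖x - y‖, fun _ h => IsPathLength.norm_sub_le h⟩ h

lemma intrinsicDist_nonneg : 0 ≤ intrinsicDist X x y :=
  Real.sInf_nonneg fun _ h => (norm_nonneg _).trans (IsPathLength.norm_sub_le h)

lemma intrinsicDist_le_norm_sub (h : segment ℝ x y ⊆ X) : intrinsicDist X x y ≤ ‖y - x‖ := by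
  refine intrinsicDist_le ⟨1, fun i => if i = 0 then x else y, by simp, by simp, ?_, by simp⟩
  intro i hi
  obtain rfl : i = 0 := by omega
  simpa using h

lemma IsOrthantSpace.norm_sub_le {m : ℕ} (hX : IsOrthantSpace m X) (hx : x ∈ X) (hy : y ∈ X) :
    ‖x - y‖ ≤ intrinsicDist X x y :=
  le_csInf (hX.exists_isPathLength hx hy) fun _ h => IsPathLength.norm_sub_le h

/-- The points of a finite subset of `[0,1]`, together with `0` and `1`, in increasing order. -/
lemma exists_partition (T : Finset ℝ) (hT : ∀ t ∈ T, 0 ≤ t ∧ t ≤ 1) :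
    ∃ (n : ℕ) (u : ℕ → ℝ), u 0 = 0 ∧ u n = 1 ∧ (∀ i < n, u i < u (i + 1)) ∧
      (∀ i ≤ n, 0 ≤ u i ∧ u i ≤ 1) ∧
      ∀ t ∈ T, (∃ i ≤ n, u i = t) ∧ ∀ i < n, t ≤ u i ∨ u (i + 1) ≤ t := by
  set S : Finset ℝ := insert 0 (insert 1 T) with hS
  have hS01 : ∀ t ∈ S, 0 ≤ t ∧ t ≤ 1 := by
    intro t ht
    simp only [hS, Finset.mem_insert] at ht
    rcases ht with rfl | rfl | ht
    · simp
    · simp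
    · exact hT t ht
  have h0 : (0 : ℝ) ∈ S := by simp [hS]
  have h1 : (1 : ℝ) ∈ S := by simp [hS]
  have hpos : 0 < S.card := Finset.card_pos.2 ⟨0, h0⟩
  obtain ⟨n, hn⟩ : ∃ n, S.card = n + 1 := ⟨S.card - 1, by omega⟩
  set φ := S.orderEmbOfFin hn with hφ
  have hmem : ∀ i, φ i ∈ S := fun i => Finset.orderEmbOfFin_mem S hn i
  have hsurj : ∀ t ∈ S, ∃ i, φ i = t := by
    intro t ht
    have : t ∈ Set.range φ := by rw [hφ, Finset.range_orderEmbOfFin]; exact ht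
    exact this
  -- The value beyond index `n` is a dummy; only the indices up to `n` matter.
  let u : ℕ → ℝ := fun i => if h : i < n + 1 then φ ⟨i, h⟩ else 1
  have hu : ∀ i (h : i < n + 1), u i = φ ⟨i, h⟩ := fun i h => dif_pos h
  refine ⟨n, u, ?_, ?_, ?_, ?_, ?_⟩
  · rw [hu 0 (by omega)]
    obtain ⟨i, hi⟩ := hsurj 0 h0
    refine le_antisymm ?_ (hS01 _ (hmem _)).1
    rw [← hi]
    exact φ.monotone (Fin.mk_le_of_le_val (Nat.zero_le _))
  · rw [hu n (by omega)]
    obtain ⟨i, hi⟩ := hsurj 1 h1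
    refine le_antisymm (hS01 _ (hmem _)).2 ?_
    rw [← hi]
    exact φ.monotone (Fin.le_last i)
  · intro i hi
    rw [hu i (by omega), hu (i + 1) (by omega)]
    exact φ.strictMono (by simp)
  · intro i hi
    rw [hu i (by omega)]
    exact hS01 _ (hmem _)
  · intro t ht
    obtain ⟨⟨j, hj⟩, rfl⟩ := hsurj t (by simp [hS, ht])
    refine ⟨⟨j, by omega, hu j hj⟩, fun i hi => ?_⟩
    rw [hu i (by omega), hu (i + 1) (by omega)]
    rcases le_or_gt j i with h | h
    · exact Or.inl (φ.monotone (by simpa using h))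
    · exact Or.inr (φ.monotone (by simpa using h))

end Orthant

/-! ### Paths with one linear stretch per coordinate, and their energy. -/

namespace Orthant

variable {M : ℕ}

/-- The point of `[l, r]` closest to `t`. -/
noncomputable def clamp (l r t : ℝ) : ℝ := max l (min t r)

lemma clamp_of_le {l r t : ℝ} (hlr : l ≤ r) (h : t ≤ l) : clamp l r t = l := by
  rw [clamp, min_eq_left (h.trans hlr), max_eq_left h]

lemma clamp_of_ge {l r t : ℝ} (hlr : l ≤ r) (h : r ≤ t) : clamp l r t = r := by
  rw [clamp, min_eq_right h, max_eq_right hlr]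

lemma clamp_of_mem {l r t : ℝ} (h₁ : l ≤ t) (h₂ : t ≤ r) : clamp l r t = t := by
  rw [clamp, min_eq_left h₂, max_eq_right h₁]

lemma le_clamp {l r t : ℝ} : l ≤ clamp l r t := le_max_left _ _

lemma clamp_le {l r t : ℝ} (hlr : l ≤ r) : clamp l r t ≤ r := max_le hlr (min_le_right _ _)

/-- The path from `x` to `y` whose coordinate `e` changes from `x e` to `y e`, at constant speed,
during the time interval `[l e, r e]`. -/
noncomputable def profile (x y : Space M) (l r : Fin M → ℝ) (t : ℝ) : Space M :=
  WithLp.toLp 2 fun e => x e + (y e - x e) / (r e - l e) * (clamp (l e) (r e) t - l e)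

/-- The energy of `profile x y l r`. -/
noncomputable def profileEnergy (x y : Space M) (l r : Fin M → ℝ) : ℝ :=
  ∑ e, (y e - x e) ^ 2 / (r e - l e)

lemma profile_apply (x y : Space M) (l r : Fin M → ℝ) (t : ℝ) (e : Fin M) :
    profile x y l r t e = x e + (y e - x e) / (r e - l e) * (clamp (l e) (r e) t - l e) := rfl

/-- The time intervals `[l e, r e]` are non-degenerate, lie in `[0,1]`, and an axis of `x` that is
incompatible with an axis of `y` is lost before the latter is gained. -/
structure Admissible (X : Set (Space M)) (x y : Space M) (l r : Fin M → ℝ) : Prop where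
  nonneg : ∀ e, 0 ≤ l e
  lt : ∀ e, l e < r e
  le_one : ∀ e, r e ≤ 1
  sep : ∀ e f, 0 < x e → 0 < y f → ¬ orthant {e, f} ⊆ X → r e ≤ l f

section

variable {X : Set (Space M)} {x y : Space M} {l r : Fin M → ℝ} {t : ℝ} {e : Fin M}

lemma profile_apply_of_le (h : l e < r e) (ht : t ≤ l e) : profile x y l r t e = x e := by
  rw [profile_apply, clamp_of_le h.le ht, sub_self, mul_zero, add_zero]

lemma profile_apply_of_ge (h : l e < r e) (ht : r e ≤ t) : profile x y l r t e = y e := by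
  have : r e - l e ≠ 0 := (sub_pos.2 h).ne'
  rw [profile_apply, clamp_of_ge h.le ht, div_mul_cancel₀ _ this]
  ring

lemma profile_apply_of_mem (h₁ : l e ≤ t) (h₂ : t ≤ r e) :
    profile x y l r t e = x e + (y e - x e) / (r e - l e) * (t - l e) := by
  rw [profile_apply, clamp_of_mem h₁ h₂]

lemma profile_zero (h : Admissible X x y l r) : profile x y l r 0 = x := by
  ext e
  exact profile_apply_of_le (h.lt e) (h.nonneg e)

lemma profile_one (h : Admissible X x y l r) : profile x y l r 1 = y := by
  ext e
  exact profile_apply_of_ge (h.lt e) (h.le_one e)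

lemma profile_nonneg (h : Admissible X x y l r) (hx : 0 ≤ x e) (hy : 0 ≤ y e) :
    0 ≤ profile x y l r t e := by
  have hlr := sub_pos.2 (h.lt e)
  have h₁ := le_clamp (l := l e) (r := r e) (t := t)
  have h₂ := clamp_le (t := t) (h.lt e).le
  have : profile x y l r t e =
      (x e * (r e - clamp (l e) (r e) t) + y e * (clamp (l e) (r e) t - l e)) / (r e - l e) := by
    rw [profile_apply]
    field_simp
    ring
  rw [this]
  exact div_nonneg (add_nonneg (mul_nonneg hx (sub_nonneg.2 h₂)) (mul_nonneg hy (sub_nonneg.2 h₁)))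
    hlr.le

lemma IsOrthantSpace.profile_mem {m : ℕ} (hX : IsOrthantSpace m X) (hx : x ∈ X) (hy : y ∈ X)
    (h : Admissible X x y l r) : profile x y l r t ∈ X := by
  -- If `e` is also an axis of `y`, or `f` also one of `x`, the pair lies in the orthant of a single
  -- endpoint. Otherwise incompatibility would force `e` to vanish before `f` appears.
  have key : ∀ e f, 0 < x e → 0 < y f → 0 < profile x y l r t e → 0 < profile x y l r t f →
      orthant {e, f} ⊆ X := by
    intro e f hxe hyf he hf
    rcases (hX.nonneg hy e).eq_or_lt with hye | hye
    · rcases (hX.nonneg hx f).eq_or_lt with hxf | hxf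
      · by_contra hef
        have hsep := h.sep e f hxe hyf hef
        rcases le_total (r e) t with ht | ht
        · rw [profile_apply_of_ge (h.lt e) ht, ← hye] at he
          exact he.false
        · rw [profile_apply_of_le (h.lt f) (ht.trans hsep), ← hxf] at hf
          exact hf.false
      · exact hX.orthant_pair_subset hx hxe hxf
    · exact hX.orthant_pair_subset hy hye hyf
  have hpos : ∀ e, 0 < profile x y l r t e → 0 < x e ∨ 0 < y e := by
    intro e he
    by_contra! hcon
    have hxe := le_antisymm hcon.1 (hX.nonneg hx e)
    have hye := le_antisymm hcon.2 (hX.nonneg hy e)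
    rw [profile_apply, hxe, hye] at he
    simp at he
  refine hX.mem_of_pairwise (fun e => profile_nonneg h (hX.nonneg hx e) (hX.nonneg hy e)) ?_
  intro e f he hf
  rcases hpos e he with hxe | hye <;> rcases hpos f hf with hxf | hyf
  · exact hX.orthant_pair_subset hx hxe hxf
  · exact key e f hxe hyf he hf
  · rw [Finset.pair_comm]
    exact key f e hxf hye hf he
  · exact hX.orthant_pair_subset hy hye hyf

end

section

variable {x y : Space M} {l r : Fin M → ℝ} {u v : ℝ}

/-- With no breakpoint strictly inside `[u, v]`, a coordinate either rests or moves throughout. This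
dichotomy makes the weighted increments in `sum_increments` telescope. -/
lemma clamp_sub_clamp_eq {l r : ℝ} (hlr : l < r) (huv : u ≤ v)
    (hl : l ≤ u ∨ v ≤ l) (hr : r ≤ u ∨ v ≤ r) :
    clamp l r v = clamp l r u ∨ clamp l r v = v ∧ clamp l r u = u := by
  rcases hl with hl | hl
  · rcases hr with hr | hr
    · left
      rw [clamp_of_ge hlr.le hr, clamp_of_ge hlr.le (hr.trans huv)]
    · right
      exact ⟨clamp_of_mem (hl.trans huv) hr, clamp_of_mem hl (huv.trans hr)⟩
  · left
    rw [clamp_of_le hlr.le hl, clamp_of_le hlr.le (huv.trans hl)]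

/-- Between breakpoints, `profile` is affine. -/
lemma profile_lineMap (hlr : ∀ e, l e < r e) (huv : u ≤ v)
    (hl : ∀ e, l e ≤ u ∨ v ≤ l e) (hr : ∀ e, r e ≤ u ∨ v ≤ r e) {θ : ℝ} (hθ : θ ∈ Set.Icc (0 : ℝ) 1) :
    (1 - θ) • profile x y l r u + θ • profile x y l r v =
      profile x y l r ((1 - θ) * u + θ * v) := by
  ext e
  have h₁ : u ≤ (1 - θ) * u + θ * v := by nlinarith [hθ.1, mul_nonneg hθ.1 (sub_nonneg.2 huv)]
  have h₂ : (1 - θ) * u + θ * v ≤ v := by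
    nlinarith [hθ.2, mul_nonneg (sub_nonneg.2 hθ.2) (sub_nonneg.2 huv)]
  simp only [PiLp.add_apply, PiLp.smul_apply, smul_eq_mul]
  rcases hl e with hl | hl
  · rcases hr e with hr | hr
    · rw [profile_apply_of_ge (hlr e) hr, profile_apply_of_ge (hlr e) (hr.trans huv),
        profile_apply_of_ge (hlr e) (hr.trans h₁)]
      ring
    · rw [profile_apply_of_mem hl (huv.trans hr), profile_apply_of_mem (hl.trans huv) hr,
        profile_apply_of_mem (hl.trans h₁) (h₂.trans hr)]
      ring
  · rw [profile_apply_of_le (hlr e) hl, profile_apply_of_le (hlr e) (huv.trans hl),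
      profile_apply_of_le (hlr e) (h₂.trans hl)]
    ring

end

/-- The increments of a coordinate of `profile` pair with those of any path that agrees with it at
the two breakpoints of this coordinate in the same way as with each other. -/
lemma sum_increments {n : ℕ} {u : ℕ → ℝ} (h0 : u 0 = 0) (h1 : u n = 1)
    (hu : ∀ i < n, u i < u (i + 1)) {l r : ℝ} (hl0 : 0 ≤ l) (hlr : l < r) (hr1 : r ≤ 1)
    (hl : ∀ i < n, l ≤ u i ∨ u (i + 1) ≤ l) (hr : ∀ i < n, r ≤ u i ∨ u (i + 1) ≤ r)
    (g : ℝ → ℝ) :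
    ∑ i ∈ Finset.range n, (clamp l r (u (i + 1)) - clamp l r (u i)) * (g (u (i + 1)) - g (u i)) /
      (u (i + 1) - u i) = g r - g l := by
  have : ∀ i ∈ Finset.range n,
      (clamp l r (u (i + 1)) - clamp l r (u i)) * (g (u (i + 1)) - g (u i)) / (u (i + 1) - u i) =
        g (clamp l r (u (i + 1))) - g (clamp l r (u i)) := by
    intro i hi
    have hi := Finset.mem_range.1 hi
    have hpos := sub_pos.2 (hu i hi)
    rcases clamp_sub_clamp_eq hlr (hu i hi).le (hl i hi) (hr i hi) with h | ⟨h, h'⟩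
    · rw [h]
      simp
    · rw [h, h', mul_div_cancel_left₀ _ hpos.ne']
  rw [Finset.sum_congr rfl this, Finset.sum_range_sub (fun i => g (clamp l r (u i))), h0, h1,
    clamp_of_ge hlr.le hr1, clamp_of_le hlr.le hl0]

/-- The energy of the piecewise linear path that takes the values `p` at the times `u`. -/
lemma sum_norm_sq_div_eq (p : ℕ → Space M) (u : ℕ → ℝ) (n : ℕ) :
    ∑ i ∈ Finset.range n, ‖p (i + 1) - p i‖ ^ 2 / (u (i + 1) - u i) =
      ∑ e, ∑ i ∈ Finset.range n, (p (i + 1) e - p i e) ^ 2 / (u (i + 1) - u i) := by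
  rw [Finset.sum_comm]
  refine Finset.sum_congr rfl fun i _ => ?_
  rw [EuclideanSpace.norm_sq_eq, Finset.sum_div]
  simp

variable {X : Set (Space M)} {x y : Space M} {l r : Fin M → ℝ}

/-- The arbitrary time `t` is added to the breakpoints so that a comparison at partition points
applies at `t`. -/
lemma exists_profile_partition (h : Admissible X x y l r) {t : ℝ} (ht : 0 ≤ t ∧ t ≤ 1) :
    ∃ (n : ℕ) (u : ℕ → ℝ), u 0 = 0 ∧ u n = 1 ∧ (∀ i < n, u i < u (i + 1)) ∧
      (∀ i ≤ n, 0 ≤ u i ∧ u i ≤ 1) ∧ (∃ i ≤ n, u i = t) ∧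
      (∀ i < n, ∀ e, l e ≤ u i ∨ u (i + 1) ≤ l e) ∧ ∀ i < n, ∀ e, r e ≤ u i ∨ u (i + 1) ≤ r e := by
  classical
  obtain ⟨n, u, h0, h1, hu, h01, hT⟩ :=
    exists_partition (insert t (Finset.univ.image l ∪ Finset.univ.image r)) (by
      intro s hs
      simp only [Finset.mem_insert, Finset.mem_union, Finset.mem_image, Finset.mem_univ,
        true_and] at hs
      rcases hs with rfl | ⟨e, rfl⟩ | ⟨e, rfl⟩
      · exact ht
      · exact ⟨h.nonneg e, (h.lt e).le.trans (h.le_one e)⟩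
      · exact ⟨(h.nonneg e).trans (h.lt e).le, h.le_one e⟩)
  refine ⟨n, u, h0, h1, hu, h01, (hT t (by simp)).1, fun i hi e => ?_, fun i hi e => ?_⟩
  · exact (hT (l e) (by simp)).2 i hi
  · exact (hT (r e) (by simp)).2 i hi

/-- This is `sum_increments` with the profile paired against itself. -/
lemma sum_profile_sq {n : ℕ} {u : ℕ → ℝ} (h : Admissible X x y l r) (h0 : u 0 = 0) (h1 : u n = 1)
    (hu : ∀ i < n, u i < u (i + 1)) (hl : ∀ i < n, ∀ e, l e ≤ u i ∨ u (i + 1) ≤ l e)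
    (hr : ∀ i < n, ∀ e, r e ≤ u i ∨ u (i + 1) ≤ r e) (e : Fin M) :
    ∑ i ∈ Finset.range n, (profile x y l r (u (i + 1)) e - profile x y l r (u i) e) ^ 2 /
      (u (i + 1) - u i) = (y e - x e) ^ 2 / (r e - l e) := by
  have key := sum_increments h0 h1 hu (h.nonneg e) (h.lt e) (h.le_one e) (fun i hi => hl i hi e)
    (fun i hi => hr i hi e) (fun t => profile x y l r t e)
  simp only at key
  rw [profile_apply_of_ge (h.lt e) le_rfl, profile_apply_of_le (h.lt e) le_rfl] at key
  have h' : (y e - x e) ^ 2 / (r e - l e) = (y e - x e) / (r e - l e) * (y e - x e) := by ring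
  rw [h']
  refine Eq.trans ?_ (congrArg ((y e - x e) / (r e - l e) * ·) key)
  simp only [Finset.mul_sum]
  refine Finset.sum_congr rfl fun i _ => ?_
  simp only [profile_apply]
  ring

lemma IsOrthantSpace.sq_intrinsicDist_le {m : ℕ} (hX : IsOrthantSpace m X) (hx : x ∈ X)
    (hy : y ∈ X) (h : Admissible X x y l r) :
    intrinsicDist X x y ^ 2 ≤ profileEnergy x y l r := by
  obtain ⟨n, u, h0, h1, hu, -, -, hl, hr⟩ :=
    exists_profile_partition h (t := 0) ⟨le_rfl, zero_le_one⟩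
  set p : ℕ → Space M := fun i => profile x y l r (u i) with hp
  have hpath : IsPathLength X x y (∑ i ∈ Finset.range n, ‖p (i + 1) - p i‖) := by
    refine ⟨n, p, ?_, ?_, fun i hi => ?_, rfl⟩
    · simp only [hp, h0, profile_zero h]
    · simp only [hp, h1, profile_one h]
    · rw [segment_eq_image]
      rintro _ ⟨θ, hθ, rfl⟩
      simp only [hp]
      rw [profile_lineMap h.lt (hu i hi).le (hl i hi) (hr i hi) hθ]
      exact hX.profile_mem hx hy h
  have henergy : profileEnergy x y l r =
      ∑ i ∈ Finset.range n, ‖p (i + 1) - p i‖ ^ 2 / (u (i + 1) - u i) := by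
    rw [sum_norm_sq_div_eq, profileEnergy]
    exact Finset.sum_congr rfl fun e _ => (sum_profile_sq h h0 h1 hu hl hr e).symm
  -- Cauchy–Schwarz in Engel form; the weights are time steps with total 1, so squared length is at
  -- most energy.
  have hCS := Finset.sq_sum_div_le_sum_sq_div (Finset.range n) (fun i => ‖p (i + 1) - p i‖)
    (g := fun i => u (i + 1) - u i) (fun i hi => sub_pos.2 (hu i (Finset.mem_range.1 hi)))
  rw [Finset.sum_range_sub, h0, h1, sub_zero, div_one, ← henergy] at hCS
  exact (pow_le_pow_left₀ intrinsicDist_nonneg (intrinsicDist_le hpath) 2).trans hCS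

/-- A path of speed at most `d(x,y)` that agrees with `profile` at the breakpoints of each
coordinate is equal to `profile`. -/
lemma IsOrthantSpace.eq_profile {m : ℕ} (hX : IsOrthantSpace m X) (hx : x ∈ X) (hy : y ∈ X)
    (h : Admissible X x y l r) {γ : ℝ → Space M} (hγ0 : γ 0 = x)
    (hγ : ∀ s ∈ Set.Icc (0 : ℝ) 1, ∀ t ∈ Set.Icc (0 : ℝ) 1,
      ‖γ s - γ t‖ ≤ |s - t| * intrinsicDist X x y)
    (hl : ∀ e, γ (l e) e = x e) (hr : ∀ e, γ (r e) e = y e) :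
    profileEnergy x y l r ≤ intrinsicDist X x y ^ 2 ∧
      ∀ t ∈ Set.Icc (0 : ℝ) 1, γ t = profile x y l r t := by
  set D := intrinsicDist X x y with hD
  have main : ∀ t ∈ Set.Icc (0 : ℝ) 1, profileEnergy x y l r ≤ D ^ 2 ∧
      γ t = profile x y l r t := by
    intro t ht
    obtain ⟨n, u, h0, h1, hu, h01, ⟨k, hkn, hk⟩, hul, hur⟩ := exists_profile_partition h ht
    set p : ℕ → Space M := fun i => γ (u i) with hp
    set q : ℕ → Space M := fun i => profile x y l r (u i) with hq
    have hup : ∑ i ∈ Finset.range n, ‖p (i + 1) - p i‖ ^ 2 / (u (i + 1) - u i) ≤ D ^ 2 := by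
      have : ∀ i ∈ Finset.range n, ‖p (i + 1) - p i‖ ^ 2 / (u (i + 1) - u i) ≤
          D ^ 2 * (u (i + 1) - u i) := by
        intro i hi
        have hi := Finset.mem_range.1 hi
        have hpos := sub_pos.2 (hu i hi)
        have hb := hγ (u (i + 1)) (h01 _ hi) (u i) (h01 _ hi.le)
        rw [abs_of_pos hpos] at hb
        rw [div_le_iff₀ hpos]
        calc ‖p (i + 1) - p i‖ ^ 2 ≤ ((u (i + 1) - u i) * D) ^ 2 :=
              pow_le_pow_left₀ (norm_nonneg _) hb 2
          _ = _ := by ring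
      refine (Finset.sum_le_sum this).trans_eq ?_
      rw [← Finset.mul_sum, Finset.sum_range_sub, h0, h1]
      ring
    -- A Pythagorean identity: the pairing of `p` with `q` equals the energy of `q`, because `γ` and
    -- the profile agree at the breakpoints of each coordinate.
    have hdiff : ∑ i ∈ Finset.range n, ‖(p - q) (i + 1) - (p - q) i‖ ^ 2 / (u (i + 1) - u i) =
        ∑ i ∈ Finset.range n, ‖p (i + 1) - p i‖ ^ 2 / (u (i + 1) - u i) -
          profileEnergy x y l r := by
      rw [sum_norm_sq_div_eq, sum_norm_sq_div_eq, profileEnergy, ← Finset.sum_sub_distrib]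
      refine Finset.sum_congr rfl fun e _ => ?_
      have hA := sum_profile_sq h h0 h1 hu hul hur e
      have hB := sum_increments h0 h1 hu (h.nonneg e) (h.lt e) (h.le_one e)
        (fun i hi => hul i hi e) (fun i hi => hur i hi e) (fun t => γ t e)
      simp only at hB
      rw [hl, hr] at hB
      have hC : (y e - x e) ^ 2 / (r e - l e) = ∑ i ∈ Finset.range n,
          (p (i + 1) e - p i e) * (q (i + 1) e - q i e) / (u (i + 1) - u i) := by
        rw [show (y e - x e) ^ 2 / (r e - l e) = (y e - x e) / (r e - l e) * (y e - x e) by ring]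
        refine (congrArg ((y e - x e) / (r e - l e) * ·) hB.symm).trans ?_
        simp only [Finset.mul_sum]
        refine Finset.sum_congr rfl fun i _ => ?_
        simp only [hp, hq, profile_apply]
        ring
      have : ∑ i ∈ Finset.range n, ((p - q) (i + 1) e - (p - q) i e) ^ 2 / (u (i + 1) - u i) =
          ∑ i ∈ Finset.range n, (p (i + 1) e - p i e) ^ 2 / (u (i + 1) - u i)
          - 2 * ∑ i ∈ Finset.range n,
            (p (i + 1) e - p i e) * (q (i + 1) e - q i e) / (u (i + 1) - u i)
          + ∑ i ∈ Finset.range n, (q (i + 1) e - q i e) ^ 2 / (u (i + 1) - u i) := by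
        rw [Finset.mul_sum, ← Finset.sum_sub_distrib, ← Finset.sum_add_distrib]
        refine Finset.sum_congr rfl fun i _ => ?_
        simp only [Pi.sub_apply, PiLp.sub_apply]
        ring
      rw [this, ← hC]
      linarith
    have hnn : ∀ i ∈ Finset.range n,
        0 ≤ ‖(p - q) (i + 1) - (p - q) i‖ ^ 2 / (u (i + 1) - u i) := fun i hi =>
      div_nonneg (sq_nonneg _) (sub_pos.2 (hu i (Finset.mem_range.1 hi))).le
    have hsum := Finset.sum_nonneg hnn
    have hle : profileEnergy x y l r ≤ D ^ 2 := by linarith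
    refine ⟨hle, ?_⟩
    have hzero : ∑ i ∈ Finset.range n, ‖(p - q) (i + 1) - (p - q) i‖ ^ 2 / (u (i + 1) - u i) = 0 := by
      have := hX.sq_intrinsicDist_le hx hy h
      linarith
    have hstep : ∀ i < n, (p - q) (i + 1) = (p - q) i := by
      intro i hi
      have := (Finset.sum_eq_zero_iff_of_nonneg hnn).1 hzero i (Finset.mem_range.2 hi)
      rw [div_eq_zero_iff, or_iff_left (sub_pos.2 (hu i hi)).ne', sq_eq_zero_iff, norm_eq_zero,
        sub_eq_zero] at this
      exact this
    have hall : ∀ i ≤ n, (p - q) i = 0 := by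
      intro i
      induction i with
      | zero =>
        intro _
        simp [hp, hq, h0, hγ0, profile_zero h]
      | succ i ih =>
        intro hi
        rw [hstep i hi, ih (by omega)]
    have := hall k hkn
    simp only [hp, hq, Pi.sub_apply, hk, sub_eq_zero] at this
    exact this
  exact ⟨(main 0 (by simp)).1, fun t ht => (main t ht).2⟩

end Orthant

/-! ### Geodesics as profiles, and their uniqueness. -/

namespace Orthant

variable {M : ℕ}

/-- The axis `e` of `x` is incompatible with some axis of `y`. -/
def Lost (X : Set (Space M)) (x y : Space M) (e : Fin M) : Prop :=
  0 < x e ∧ ∃ f, 0 < y f ∧ ¬ orthant {e, f} ⊆ X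

/-- The axis `f` of `y` is incompatible with some axis of `x`. -/
def Gained (X : Set (Space M)) (x y : Space M) (f : Fin M) : Prop :=
  0 < y f ∧ ∃ e, 0 < x e ∧ ¬ orthant {e, f} ⊆ X

/-- The coordinate `e` of the path `γ` from `x` to `y` changes during the time interval
`[l e, r e]`, which is all of `[0,1]` unless the axis `e` is lost or gained. -/
structure IsSchedule (X : Set (Space M)) (x y : Space M) (γ : ℝ → Space M) (l r : Fin M → ℝ) :
    Prop extends Admissible X x y l r where
  start : ∀ e, γ (l e) e = x e
  finish : ∀ e, γ (r e) e = y e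
  left_eq_zero : ∀ e, ¬ Gained X x y e → l e = 0
  right_eq_one : ∀ e, ¬ Lost X x y e → r e = 1

variable {m : ℕ} {X : Set (Space M)} {x y : Space M} {l r l' r' : Fin M → ℝ} {γ γ' : ℝ → Space M}

/-- Two axes of the same point of `X` are always compatible. -/
lemma Lost.target_eq_zero {e : Fin M} (hX : IsOrthantSpace m X) (hy : y ∈ X) (h : Lost X x y e) :
    y e = 0 := by
  obtain ⟨-, f, hf, hef⟩ := h
  by_contra hne
  exact hef (hX.orthant_pair_subset hy ((hX.nonneg hy e).lt_of_ne' hne) hf)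

lemma Gained.source_eq_zero {e : Fin M} (hX : IsOrthantSpace m X) (hx : x ∈ X)
    (h : Gained X x y e) : x e = 0 := by
  obtain ⟨-, f, hf, hef⟩ := h
  by_contra hne
  exact hef (hX.orthant_pair_subset hx hf ((hX.nonneg hx e).lt_of_ne' hne))

lemma Lost.not_gained {e : Fin M} (hX : IsOrthantSpace m X) (hy : y ∈ X) (h : Lost X x y e) :
    ¬ Gained X x y e := fun h' => h'.1.ne' (h.target_eq_zero hX hy)

lemma Admissible.left_pos_of_gained {e : Fin M} (h : Admissible X x y l r) (he : Gained X x y e) :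
    0 < l e := by
  obtain ⟨hye, f, hf, hef⟩ := he
  exact ((h.nonneg f).trans_lt (h.lt f)).trans_le (h.sep f e hf hye hef)

lemma Admissible.right_lt_one_of_lost {e : Fin M} (h : Admissible X x y l r) (he : Lost X x y e) :
    r e < 1 := by
  obtain ⟨hxe, f, hf, hef⟩ := he
  exact (h.sep e f hxe hf hef).trans_lt ((h.lt f).trans_le (h.le_one f))

lemma IsGeodesic.norm_sub_le (hγ : IsGeodesic X x y γ) (hX : IsOrthantSpace m X) :
    ∀ s ∈ Set.Icc (0 : ℝ) 1, ∀ t ∈ Set.Icc (0 : ℝ) 1,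
      ‖γ s - γ t‖ ≤ |s - t| * intrinsicDist X x y := by
  intro s hs t ht
  rw [← hγ.dist_eq s hs t ht]
  exact hX.norm_sub_le (hγ.mem s hs) (hγ.mem t ht)

lemma IsGeodesic.continuousOn (hγ : IsGeodesic X x y γ) (hX : IsOrthantSpace m X) :
    ContinuousOn γ (Set.Icc 0 1) := by
  have : LipschitzOnWith (Real.toNNReal (intrinsicDist X x y)) γ (Set.Icc 0 1) := by
    refine LipschitzOnWith.of_dist_le_mul fun s hs t ht => ?_
    rw [dist_eq_norm, Real.dist_eq, Real.coe_toNNReal _ intrinsicDist_nonneg, mul_comm]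
    exact hγ.norm_sub_le hX s hs t ht
  exact this.continuousOn

lemma exists_first_zero {g : ℝ → ℝ} (hg : ContinuousOn g (Set.Icc 0 1)) (h0 : 0 < g 0)
    (h1 : g 1 = 0) (hnn : ∀ t ∈ Set.Icc (0 : ℝ) 1, 0 ≤ g t) :
    ∃ r, 0 < r ∧ r ≤ 1 ∧ g r = 0 ∧ ∀ t, 0 ≤ t → t < r → 0 < g t := by
  have hc : IsCompact (Set.Icc (0 : ℝ) 1 ∩ g ⁻¹' {0}) :=
    isCompact_Icc.of_isClosed_subset (hg.preimage_isClosed_of_isClosed isClosed_Icc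
      isClosed_singleton) Set.inter_subset_left
  obtain ⟨r, ⟨hr, hgr⟩, hmin⟩ := hc.exists_isLeast ⟨1, by simp, h1⟩
  refine ⟨r, hr.1.lt_of_ne ?_, hr.2, hgr, fun t ht htr => ?_⟩
  · rintro rfl
    exact h0.ne' hgr
  · have ht1 : t ∈ Set.Icc (0 : ℝ) 1 := ⟨ht, htr.le.trans hr.2⟩
    refine (hnn t ht1).lt_of_ne' fun h => ?_
    exact htr.not_ge (hmin ⟨ht1, h⟩)

lemma exists_last_zero {g : ℝ → ℝ} (hg : ContinuousOn g (Set.Icc 0 1)) (h0 : g 0 = 0)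
    (h1 : 0 < g 1) (hnn : ∀ t ∈ Set.Icc (0 : ℝ) 1, 0 ≤ g t) :
    ∃ l, 0 ≤ l ∧ l < 1 ∧ g l = 0 ∧ ∀ t, l < t → t ≤ 1 → 0 < g t := by
  obtain ⟨r, hr0, hr1, hgr, hpos⟩ := exists_first_zero (g := fun t => g (1 - t))
    (hg.comp (by fun_prop) fun t ht => ⟨by linarith [ht.2], by linarith [ht.1]⟩)
    (by simpa using h1) (by simpa using h0)
    (fun t ht => hnn _ ⟨by linarith [ht.2], by linarith [ht.1]⟩)
  refine ⟨1 - r, by linarith, by linarith, hgr, fun t ht ht1 => ?_⟩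
  simpa using hpos (1 - t) (by linarith) (by linarith)

lemma IsGeodesic.exists_isSchedule (hγ : IsGeodesic X x y γ) (hX : IsOrthantSpace m X)
    (hx : x ∈ X) (hy : y ∈ X) : ∃ l r, IsSchedule X x y γ l r := by
  have hcont : ∀ e, ContinuousOn (fun t => γ t e) (Set.Icc 0 1) := fun e =>
    (PiLp.continuous_apply 2 (fun _ : Fin M => ℝ) e).comp_continuousOn (hγ.continuousOn hX)
  have hnn : ∀ e, ∀ t ∈ Set.Icc (0 : ℝ) 1, 0 ≤ γ t e := fun e t ht => hX.nonneg (hγ.mem t ht) e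
  have hr : ∀ e, ∃ r, 0 < r ∧ r ≤ 1 ∧ γ r e = y e ∧ (¬ Lost X x y e → r = 1) ∧
      (Lost X x y e → ∀ t, 0 ≤ t → t < r → 0 < γ t e) := by
    intro e
    by_cases he : Lost X x y e
    · obtain ⟨r, h0, h1, h, hpos⟩ := exists_first_zero (hcont e) (by rw [hγ.source]; exact he.1)
        (by rw [hγ.target]; exact he.target_eq_zero hX hy) (hnn e)
      exact ⟨r, h0, h1, h.trans (he.target_eq_zero hX hy).symm, fun h => absurd he h, fun _ => hpos⟩
    · exact ⟨1, one_pos, le_rfl, by rw [hγ.target], fun _ => rfl, fun h => absurd h he⟩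
  have hl : ∀ e, ∃ l, 0 ≤ l ∧ l < 1 ∧ γ l e = x e ∧ (¬ Gained X x y e → l = 0) ∧
      (Gained X x y e → ∀ t, l < t → t ≤ 1 → 0 < γ t e) := by
    intro e
    by_cases he : Gained X x y e
    · obtain ⟨l, h0, h1, h, hpos⟩ := exists_last_zero (hcont e)
        (by rw [hγ.source]; exact he.source_eq_zero hX hx) (by rw [hγ.target]; exact he.1) (hnn e)
      exact ⟨l, h0, h1, h.trans (he.source_eq_zero hX hx).symm, fun h => absurd he h, fun _ => hpos⟩
    · exact ⟨0, le_rfl, one_pos, by rw [hγ.source], fun _ => rfl, fun h => absurd h he⟩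
  choose r hr0 hr1 hry hr' hrpos using hr
  choose l hl0 hl1 hlx hl' hlpos using hl
  refine ⟨l, r, ⟨hl0, fun e => ?_, hr1, fun e f he hf hef => ?_⟩, hlx, hry, hl', hr'⟩
  · by_cases he : Lost X x y e
    · rw [hl' e (he.not_gained hX hy)]
      exact hr0 e
    · rw [hr' e he]
      exact hl1 e
  -- Halfway between `l f` and `r e` both coordinates would be positive, although no point of `X`
  -- has both `e` and `f` as axes.
  · by_contra! hlt
    have ht0 : 0 ≤ (l f + r e) / 2 := by linarith [hl0 f, hr0 e]
    have ht1 : (l f + r e) / 2 ≤ 1 := by linarith [hl1 f, hr1 e]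
    exact hef (hX.orthant_pair_subset (hγ.mem _ ⟨ht0, ht1⟩)
      (hrpos e ⟨he, f, hf, hef⟩ _ ht0 (by linarith))
      (hlpos f ⟨hf, e, he, hef⟩ _ (by linarith) ht1))

lemma IsGeodesic.eq_profile (hγ : IsGeodesic X x y γ) (hX : IsOrthantSpace m X)
    (hx : x ∈ X) (hy : y ∈ X) (h : IsSchedule X x y γ l r) :
    profileEnergy x y l r ≤ intrinsicDist X x y ^ 2 ∧
      ∀ t ∈ Set.Icc (0 : ℝ) 1, γ t = profile x y l r t :=
  hX.eq_profile hx hy h.toAdmissible hγ.source (hγ.norm_sub_le hX) h.start h.finish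

lemma Admissible.average (h : Admissible X x y l r) (h' : Admissible X x y l' r') :
    Admissible X x y (fun e => (l e + l' e) / 2) (fun e => (r e + r' e) / 2) where
  nonneg e := by linarith [h.nonneg e, h'.nonneg e]
  lt e := by linarith [h.lt e, h'.lt e]
  le_one e := by linarith [h.le_one e, h'.le_one e]
  sep e f he hf hef := by linarith [h.sep e f he hf hef, h'.sep e f he hf hef]

/-- The explicit convexity gap of `p ↦ d² / p`; it vanishes only if `d = 0` or `p = q`. -/
lemma div_add_div_sub_div_average {p q d : ℝ} (hp : 0 < p) (hq : 0 < q) :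
    (d ^ 2 / p + d ^ 2 / q) / 2 - d ^ 2 / ((p + q) / 2) =
      d ^ 2 * (p - q) ^ 2 / (2 * p * q * (p + q)) := by
  have := (add_pos hp hq).ne'
  field_simp
  ring

/-- Geodesics of an orthant space are unique. -/
lemma IsGeodesic.eqOn (hγ : IsGeodesic X x y γ) (hγ' : IsGeodesic X x y γ')
    (hX : IsOrthantSpace m X) (hx : x ∈ X) (hy : y ∈ X) : Set.EqOn γ γ' (Set.Icc 0 1) := by
  obtain ⟨l, r, h⟩ := hγ.exists_isSchedule hX hx hy
  obtain ⟨l', r', h'⟩ := hγ'.exists_isSchedule hX hx hy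
  obtain ⟨hE, hp⟩ := hγ.eq_profile hX hx hy h
  obtain ⟨hE', hp'⟩ := hγ'.eq_profile hX hx hy h'
  -- The averaged schedule cannot have energy below the minimum attained by both geodesics, so every
  -- convexity gap is zero.
  have hav := hX.sq_intrinsicDist_le hx hy (h.toAdmissible.average h'.toAdmissible)
  have hgap : ∀ e, ((y e - x e) ^ 2 / (r e - l e) + (y e - x e) ^ 2 / (r' e - l' e)) / 2 -
      (y e - x e) ^ 2 / ((r e + r' e) / 2 - (l e + l' e) / 2) =
      (y e - x e) ^ 2 * ((r e - l e) - (r' e - l' e)) ^ 2 /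
        (2 * (r e - l e) * (r' e - l' e) * ((r e - l e) + (r' e - l' e))) := by
    intro e
    rw [← div_add_div_sub_div_average (sub_pos.2 (h.lt e)) (sub_pos.2 (h'.lt e))]
    congr 2
    ring
  have hgap0 : ∀ e ∈ Finset.univ, 0 ≤ (y e - x e) ^ 2 * ((r e - l e) - (r' e - l' e)) ^ 2 /
        (2 * (r e - l e) * (r' e - l' e) * ((r e - l e) + (r' e - l' e))) := by
    intro e _
    have := sub_pos.2 (h.lt e)
    have := sub_pos.2 (h'.lt e)
    positivity
  have hsum : ∑ e, (y e - x e) ^ 2 * ((r e - l e) - (r' e - l' e)) ^ 2 /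
        (2 * (r e - l e) * (r' e - l' e) * ((r e - l e) + (r' e - l' e))) = 0 := by
    refine le_antisymm ?_ (Finset.sum_nonneg hgap0)
    rw [← Finset.sum_congr rfl fun e _ => hgap e, Finset.sum_sub_distrib, ← Finset.sum_div,
      Finset.sum_add_distrib]
    simp only [profileEnergy] at hE hE' hav
    linarith
  intro t ht
  rw [hp t ht, hp' t ht]
  ext e
  have he := (Finset.sum_eq_zero_iff_of_nonneg hgap0).1 hsum e (Finset.mem_univ e)
  have h₁ := sub_pos.2 (h.lt e)
  have h₂ := sub_pos.2 (h'.lt e)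
  rw [div_eq_zero_iff, or_iff_left (by positivity), mul_eq_zero, sq_eq_zero_iff,
    sq_eq_zero_iff] at he
  -- Either the coordinate never moves, or both intervals have the same length. As no axis is both
  -- lost and gained, they also share an endpoint, `0` or `1`.
  rcases he with he | he
  · simp [profile_apply, he]
  · by_cases hL : Lost X x y e
    · have hl : l e = 0 := h.left_eq_zero e (hL.not_gained hX hy)
      have hl' : l' e = 0 := h'.left_eq_zero e (hL.not_gained hX hy)
      have hr : r e = r' e := by linarith
      simp [profile_apply, hl, hl', hr]
    · have hr : r e = 1 := h.right_eq_one e hL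
      have hr' : r' e = 1 := h'.right_eq_one e hL
      have hl : l e = l' e := by linarith
      simp [profile_apply, hr, hr', hl]

/-! ### The logarithm as an initial velocity. -/

/-- The initial velocity of `profile`. -/
noncomputable def profileVelocity (x y : Space M) (l r : Fin M → ℝ) : Space M :=
  WithLp.toLp 2 fun e => if l e = 0 then (y e - x e) / r e else 0

lemma exists_profile_eq_add_smul (h : Admissible X x y l r) :
    ∃ δ, 0 < δ ∧ δ ≤ 1 ∧ ∀ t, 0 ≤ t → t ≤ δ →
      profile x y l r t = x + t • profileVelocity x y l r := by
  have : ∀ e, ∃ δ, 0 < δ ∧ ∀ t, 0 ≤ t → t ≤ δ →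
      profile x y l r t e = x e + t * profileVelocity x y l r e := by
    intro e
    by_cases he : l e = 0
    · refine ⟨r e, he ▸ h.lt e, fun t h0 ht => ?_⟩
      rw [profile_apply_of_mem (he.trans_le h0) ht]
      simp only [profileVelocity, he, if_true]
      ring
    · refine ⟨l e, (h.nonneg e).lt_of_ne' he, fun t _ ht => ?_⟩
      rw [profile_apply_of_le (h.lt e) ht]
      simp [profileVelocity, he]
  choose δ hδ hδ' using this
  obtain ⟨ε, hε, hε'⟩ : ∃ ε, 0 < ε ∧ ∀ e, ε ≤ δ e := by
    rcases isEmpty_or_nonempty (Fin M) with hM | hM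
    · exact ⟨1, one_pos, fun e => hM.elim e⟩
    · obtain ⟨e, he⟩ := Finite.exists_min δ
      exact ⟨δ e, hδ e, he⟩
  refine ⟨min ε 1, lt_min hε one_pos, min_le_right _ _, fun t h0 ht => ?_⟩
  ext e
  simpa using hδ' e t h0 ((ht.trans (min_le_left _ _)).trans (hε' e))

lemma IsGeodesic.hasDerivWithinAt (hγ : IsGeodesic X x y γ) (hX : IsOrthantSpace m X)
    (hx : x ∈ X) (hy : y ∈ X) (h : IsSchedule X x y γ l r) :
    HasDerivWithinAt γ (profileVelocity x y l r) (Set.Icc 0 1) 0 ∧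
      ‖profileVelocity x y l r‖ = intrinsicDist X x y := by
  obtain ⟨δ, hδ, hδ1, hlin⟩ := exists_profile_eq_add_smul h.toAdmissible
  set v := profileVelocity x y l r
  have hp := (hγ.eq_profile hX hx hy h).2
  have hγlin : ∀ t, 0 ≤ t → t ≤ δ → γ t = x + t • v := fun t h0 ht => by
    rw [hp t ⟨h0, ht.trans hδ1⟩, hlin t h0 ht]
  constructor
  · have hd : HasDerivWithinAt (fun t : ℝ => x + t • v) v (Set.Icc 0 1) 0 := by
      simpa using (((hasDerivAt_id (0 : ℝ)).smul_const v).const_add x).hasDerivWithinAt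
    refine hd.congr_of_eventuallyEq ?_ (by rw [hγlin 0 le_rfl hδ.le])
    filter_upwards [self_mem_nhdsWithin, mem_nhdsWithin_of_mem_nhds (Iio_mem_nhds hδ)]
      with t ht htδ using hγlin t ht.1 (le_of_lt htδ)
  -- The norm is read off from the straight initial piece: this segment lies in `X`, so intrinsic
  -- and Euclidean distance agree on it.
  · have hdist : intrinsicDist X x (γ δ) = δ * intrinsicDist X x y := by
      have := hγ.dist_eq 0 (by simp) δ ⟨hδ.le, hδ1⟩
      rwa [hγ.source, zero_sub, abs_neg, abs_of_pos hδ] at this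
    have hmem : γ δ ∈ X := hγ.mem δ ⟨hδ.le, hδ1⟩
    have hnorm : ‖γ δ - x‖ = δ * ‖v‖ := by
      rw [hγlin δ hδ.le le_rfl, add_sub_cancel_left, norm_smul, Real.norm_of_nonneg hδ.le]
    have hle : ‖γ δ - x‖ ≤ intrinsicDist X x (γ δ) := by
      rw [norm_sub_rev]
      exact hX.norm_sub_le hx hmem
    have hge : intrinsicDist X x (γ δ) ≤ ‖γ δ - x‖ := by
      refine intrinsicDist_le_norm_sub ?_
      rw [segment_eq_image']
      rintro _ ⟨θ, hθ, rfl⟩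
      have hθδ : θ * δ ≤ δ := mul_le_of_le_one_left hδ.le hθ.2
      have h0 : 0 ≤ θ * δ := mul_nonneg hθ.1 hδ.le
      have : x + θ • (γ δ - x) = γ (θ * δ) := by
        rw [hγlin δ hδ.le le_rfl, hγlin _ h0 hθδ, add_sub_cancel_left, smul_smul]
      simp only [this]
      exact hγ.mem _ ⟨h0, hθδ.trans hδ1⟩
    exact mul_left_cancel₀ hδ.ne' (by rw [← hnorm, ← hdist]; exact le_antisymm hle hge)

/-- The choice made by `Classical.epsilon` is harmless: geodesics are unique, and so are one-sided
derivatives. -/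
lemma IsGeodesic.logMap_eq (hγ : IsGeodesic X x y γ) (hX : IsOrthantSpace m X)
    (hx : x ∈ X) (hy : y ∈ X) (h : IsSchedule X x y γ l r) :
    logMap X x y = profileVelocity x y l r := by
  obtain ⟨hd, hn⟩ := hγ.hasDerivWithinAt hX hx hy h
  obtain ⟨γ', hγ', hd', -⟩ : IsLog X x y (logMap X x y) :=
    Classical.epsilon_spec (p := IsLog X x y) ⟨_, γ, hγ, hd, hn⟩
  have h0 : (0 : ℝ) ∈ Set.Icc (0 : ℝ) 1 := by simp
  have heq := hγ.eqOn hγ' hX hx hy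
  exact (uniqueDiffOn_Icc one_pos 0 h0).eq_deriv _ (hd'.congr heq (heq h0)) hd

lemma mem_commonAxes_iff (hX : IsOrthantSpace m X) (hx : x ∈ X) (hy : y ∈ X) {e : Fin M} :
    e ∈ commonAxes X x y ↔ (0 < x e ∨ 0 < y e) ∧ ¬ Lost X x y e ∧ ¬ Gained X x y e := by
  have hcomp : ∀ {e : Fin M} {z : Space M}, z ∈ X → orthant {e} ⊆ X →
      (∀ f, 0 < z f → orthant {e, f} ⊆ X) → Compatible X {e} (posAxes z) := by
    intro e z hz he h
    refine hX.orthant_subset_of_pairwise ?_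
    have hpos : ∀ f, f ∈ posAxes z → 0 < z f := fun f hf => mem_posAxes.1 hf
    intro f hf g hg
    rcases Finset.mem_union.1 hf with hf | hf <;> rcases Finset.mem_union.1 hg with hg | hg
    · rw [Finset.mem_singleton.1 hf, Finset.mem_singleton.1 hg]
      simpa using he
    · rw [Finset.mem_singleton.1 hf]
      exact h g (hpos g hg)
    · rw [Finset.mem_singleton.1 hg, Finset.pair_comm]
      exact h f (hpos f hf)
    · exact hX.orthant_pair_subset hz (hpos f hf) (hpos g hg)
  have hsub : ∀ {e f : Fin M} {z : Space M}, Compatible X {e} (posAxes z) → 0 < z f →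
      orthant {e, f} ⊆ X := by
    intro e f z h hf
    refine hX.face _ _ ?_ h
    intro i hi
    rcases Finset.mem_insert.1 hi with rfl | hi
    · simp
    · rw [Finset.mem_singleton.1 hi]
      simp [mem_posAxes, hf]
  have hsing : ∀ {e : Fin M} {z : Space M}, z ∈ X → 0 < z e → orthant {e} ⊆ X := by
    intro e z hz he
    simpa using hX.orthant_pair_subset hz he he
  have hmem : e ∈ commonAxes X x y ↔ 0 < x e ∧ 0 < y e ∨
      0 < x e ∧ Compatible X {e} (posAxes y) ∨ 0 < y e ∧ Compatible X {e} (posAxes x) := by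
    simp only [commonAxes, Finset.mem_union, Finset.mem_inter, Finset.mem_filter, mem_posAxes,
      or_assoc]
  rw [hmem]
  constructor
  · rintro (⟨hxe, hye⟩ | ⟨hxe, hc⟩ | ⟨hye, hc⟩)
    · exact ⟨Or.inl hxe, fun h => hye.ne' (h.target_eq_zero hX hy),
        fun h => hxe.ne' (h.source_eq_zero hX hx)⟩
    · exact ⟨Or.inl hxe, fun ⟨_, f, hf, hef⟩ => hef (hsub hc hf),
        fun h => hxe.ne' (h.source_eq_zero hX hx)⟩
    · exact ⟨Or.inr hye, fun h => hye.ne' (h.target_eq_zero hX hy),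
        fun ⟨_, f, hf, hef⟩ => hef (by rw [Finset.pair_comm]; exact hsub hc hf)⟩
  · rintro ⟨hxe | hye, hL, hG⟩
    · refine Or.inr (Or.inl ⟨hxe, hcomp hy (hsing hx hxe) fun f hf => ?_⟩)
      by_contra hef
      exact hL ⟨hxe, f, hf, hef⟩
    · refine Or.inr (Or.inr ⟨hye, hcomp hx (hsing hy hye) fun f hf => ?_⟩)
      by_contra hef
      exact hG ⟨hye, f, hf, by rwa [Finset.pair_comm]⟩

end Orthant

/-! ### The support, and the exchange times it determines. -/

namespace Orthant

variable {M k m : ℕ} {X : Set (Space M)} {x y : Space M} {l r : Fin M → ℝ} {γ : ℝ → Space M}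
  {A B : Fin (k + 1) → Finset (Fin M)}

lemma mem_carrierAxes {i : Fin (k + 1)} {e : Fin M} :
    e ∈ carrierAxes A B i ↔ e ∈ A 0 ∨ (∃ j, (0 < j ∧ j ≤ i) ∧ e ∈ B j) ∨ ∃ j, i < j ∧ e ∈ A j := by
  simp [carrierAxes]

lemma IsSupport.mem_carrierAxes_of_mem_A (h : IsSupport X x y γ A B) {j : Fin (k + 1)}
    (hj : j ≠ 0) {e : Fin M} (he : e ∈ A j) (i : Fin (k + 1)) :
    e ∈ carrierAxes A B i ↔ i < j := by
  rw [mem_carrierAxes]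
  constructor
  · rintro (h0 | ⟨j', ⟨hj', -⟩, h'⟩ | ⟨j', hij', h'⟩)
    · exact absurd h0 (Finset.disjoint_left.1 (h.disjoint_A j 0 hj) he)
    · exact absurd h' (Finset.disjoint_left.1 (h.disjoint_AB j j' hj hj'.ne') he)
    · by_contra hij
      have : j ≠ j' := by rintro rfl; exact hij hij'
      exact Finset.disjoint_left.1 (h.disjoint_A j j' this) he h'
  · exact fun hij => Or.inr (Or.inr ⟨j, hij, he⟩)

lemma IsSupport.mem_carrierAxes_of_mem_B (h : IsSupport X x y γ A B) {j : Fin (k + 1)}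
    (hj : j ≠ 0) {e : Fin M} (he : e ∈ B j) (i : Fin (k + 1)) :
    e ∈ carrierAxes A B i ↔ j ≤ i := by
  rw [mem_carrierAxes]
  constructor
  · rintro (h0 | ⟨j', ⟨-, hij'⟩, h'⟩ | ⟨j', hij', h'⟩)
    · rw [h.A_zero, ← h.B_zero] at h0
      exact absurd h0 (Finset.disjoint_left.1 (h.disjoint_B j 0 hj) he)
    · by_contra hij
      have : j ≠ j' := by rintro rfl; exact hij hij'
      exact Finset.disjoint_left.1 (h.disjoint_B j j' this) he h'
    · exact absurd he
        (Finset.disjoint_left.1 (h.disjoint_AB j' j ((Fin.zero_le i).trans_lt hij').ne' hj) h')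
  · exact fun hij => Or.inr (Or.inl ⟨j, ⟨Fin.pos_iff_ne_zero.2 hj, hij⟩, he⟩)

lemma IsSchedule.profile_pos_iff_of_lost (h : IsSchedule X x y γ l r) (hX : IsOrthantSpace m X)
    (hy : y ∈ X) {e : Fin M} (he : Lost X x y e) {t : ℝ} (ht : 0 ≤ t) :
    0 < profile x y l r t e ↔ t < r e := by
  have hl : l e = 0 := h.left_eq_zero e (he.not_gained hX hy)
  have hr : 0 < r e := hl ▸ h.lt e
  have hye := he.target_eq_zero hX hy
  constructor
  · intro hp
    by_contra! hrt
    rw [profile_apply_of_ge (h.lt e) hrt, hye] at hp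
    exact hp.false
  · intro htr
    have : profile x y l r t e = x e * (r e - t) / r e := by
      rw [profile_apply_of_mem (hl.trans_le ht) htr.le, hl, hye, sub_zero, sub_zero]
      have := hr.ne'
      field_simp
      ring
    rw [this]
    exact div_pos (mul_pos he.1 (sub_pos.2 htr)) hr

lemma IsSchedule.profile_pos_iff_of_gained (h : IsSchedule X x y γ l r) (hX : IsOrthantSpace m X)
    (hx : x ∈ X) (hy : y ∈ X) {e : Fin M} (he : Gained X x y e) {t : ℝ} (ht : t ≤ 1) :
    0 < profile x y l r t e ↔ l e < t := by
  have hr : r e = 1 := h.right_eq_one e fun hL => hL.not_gained hX hy he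
  have hl : l e < 1 := hr ▸ h.lt e
  have hxe := he.source_eq_zero hX hx
  constructor
  · intro hp
    by_contra! hrt
    rw [profile_apply_of_le (h.lt e) hrt, hxe] at hp
    exact hp.false
  · intro htl
    rw [profile_apply_of_mem htl.le (ht.trans hr.ge), hr, hxe, zero_add, sub_zero]
    exact mul_pos (div_pos he.1 (sub_pos.2 hl)) (sub_pos.2 htl)

lemma pos_of_profile_pos (hX : IsOrthantSpace m X) (hx : x ∈ X) (hy : y ∈ X)
    {e : Fin M} {t : ℝ} (h : 0 < profile x y l r t e) : 0 < x e ∨ 0 < y e := by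
  by_contra! hcon
  have hxe := le_antisymm hcon.1 (hX.nonneg hx e)
  have hye := le_antisymm hcon.2 (hX.nonneg hy e)
  rw [profile_apply, hxe, hye] at h
  simp at h

/-- The axes in `A j` are those lost, and the axes in `B j` those gained, at the time `s j` at
which the geodesic enters the `j`-th stratum of its carrier. -/
lemma IsSupport.exists_times (hAB : IsSupport X x y γ A B) (hγ : IsGeodesic X x y γ)
    (hX : IsOrthantSpace m X) (hx : x ∈ X) (hy : y ∈ X) (h : IsSchedule X x y γ l r) :
    ∃ s : Fin (k + 2) → ℝ, StrictMono s ∧ s 0 = 0 ∧ s (Fin.last (k + 1)) = 1 ∧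
      (∀ j ≠ 0, ∀ e ∈ A j, Lost X x y e ∧ r e = s j.castSucc) ∧
      (∀ j ≠ 0, ∀ e ∈ B j, Gained X x y e ∧ l e = s j.castSucc) ∧
      (∀ e, Lost X x y e → ∃ j ≠ 0, e ∈ A j) ∧ (∀ e, Gained X x y e → ∃ j ≠ 0, e ∈ B j) := by
  obtain ⟨⟨s, hs, hs0, hs1, hstr⟩, -⟩ := hAB.carrier
  have hp := (hγ.eq_profile hX hx hy h).2
  have hpos : ∀ (i : Fin (k + 1)) (t : ℝ), s i.castSucc < t → t < s i.succ → ∀ e,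
      0 < profile x y l r t e ↔ e ∈ carrierAxes A B i := by
    intro i t h₁ h₂ e
    have ht0 : 0 ≤ t := by
      rw [← hs0]
      exact (hs.monotone (Fin.zero_le _)).trans h₁.le
    have ht1 : t ≤ 1 := by
      rw [← hs1]
      exact h₂.le.trans (hs.monotone (Fin.le_last _))
    rw [← hp t ⟨ht0, ht1⟩, ← mem_posAxes, posAxes_eq_of_mem_orthant (hstr i t ⟨h₁, h₂⟩)]
  have hlt : ∀ i : Fin (k + 1), s i.castSucc < s i.succ := fun i => hs Fin.castSucc_lt_succ
  have hnn : ∀ i, 0 ≤ s i := fun i => hs0.symm.trans_le (hs.monotone (Fin.zero_le i))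
  have hle1 : ∀ i, s i ≤ 1 := fun i => (hs.monotone (Fin.le_last i)).trans_eq hs1
  have hfirst : ∀ e, ∀ ε > 0, ∃ t, 0 < t ∧ t < ε ∧
      (0 < profile x y l r t e ↔ e ∈ carrierAxes A B 0) := by
    intro e ε hε
    have h0 : s (Fin.castSucc 0) = 0 := hs0
    obtain ⟨t, ht0, ht⟩ := exists_between (lt_min hε (h0 ▸ hlt 0))
    exact ⟨t, ht0, ht.trans_le (min_le_left _ _),
      hpos 0 t (h0.trans_lt ht0) (ht.trans_le (min_le_right _ _)) e⟩
  have hlast : ∀ e, ∀ ε < 1, ∃ t, ε < t ∧ t < 1 ∧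
      (0 < profile x y l r t e ↔ e ∈ carrierAxes A B (Fin.last k)) := by
    intro e ε hε
    have h1 : s (Fin.succ (Fin.last k)) = 1 := hs1
    obtain ⟨t, ht, ht1⟩ := exists_between (max_lt hε (h1 ▸ hlt (Fin.last k)))
    exact ⟨t, (le_max_left _ _).trans_lt ht, ht1,
      hpos _ t ((le_max_right _ _).trans_lt ht) (ht1.trans_eq h1.symm) e⟩
  have hnotcommon : ∀ {e t}, 0 < profile x y l r t e → e ∉ A 0 → Lost X x y e ∨ Gained X x y e := by
    intro e t ht he
    rw [hAB.A_zero, mem_commonAxes_iff hX hx hy] at he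
    have := pos_of_profile_pos hX hx hy ht
    tauto
  have hLA : ∀ j ≠ 0, ∀ e ∈ A j, Lost X x y e := by
    intro j hj e he
    have hmem := (hAB.mem_carrierAxes_of_mem_A hj he 0).2 (Fin.pos_iff_ne_zero.2 hj)
    have hA0 : e ∉ A 0 := Finset.disjoint_left.1 (hAB.disjoint_A j 0 hj) he
    obtain ⟨t, -, -, ht⟩ := hfirst e 1 one_pos
    -- A gained axis stays at zero until the positive time `l e`, whereas `e` belongs to the initial
    -- stratum.
    refine (hnotcommon (ht.2 hmem) hA0).resolve_right fun hG => ?_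
    obtain ⟨t, ht0, htl, ht⟩ := hfirst e (l e) (h.toAdmissible.left_pos_of_gained hG)
    have := ht.2 hmem
    rw [h.profile_pos_iff_of_gained hX hx hy hG
      (htl.le.trans ((h.lt e).le.trans (h.le_one e)))] at this
    exact this.not_gt htl
  have hGB : ∀ j ≠ 0, ∀ e ∈ B j, Gained X x y e := by
    intro j hj e he
    have hmem := (hAB.mem_carrierAxes_of_mem_B hj he (Fin.last k)).2 (Fin.le_last j)
    have hA0 : e ∉ A 0 := by
      rw [hAB.A_zero, ← hAB.B_zero]
      exact Finset.disjoint_left.1 (hAB.disjoint_B j 0 hj) he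
    obtain ⟨t, -, -, ht⟩ := hlast e 0 one_pos
    refine (hnotcommon (ht.2 hmem) hA0).resolve_left fun hL => ?_
    obtain ⟨t, htr, -, ht⟩ := hlast e (r e) (h.toAdmissible.right_lt_one_of_lost hL)
    have := ht.2 hmem
    rw [h.profile_pos_iff_of_lost hX hy hL
      (((h.nonneg e).trans (h.lt e).le).trans htr.le)] at this
    exact this.not_gt htr
  refine ⟨s, hs, hs0, hs1, fun j hj e he => ⟨hLA j hj e he, ?_⟩,
    fun j hj e he => ⟨hGB j hj e he, ?_⟩, fun e he => ?_, fun e he => ?_⟩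
  · have hL := hLA j hj e he
    -- A time just after `s j` excludes vanishing later, since `e` is absent from the `j`-th
    -- stratum; a time just before excludes vanishing earlier, since `e` is present in the preceding
    -- one.
    refine le_antisymm (le_of_not_gt fun hlt' => ?_) (le_of_not_gt fun hlt' => ?_)
    · obtain ⟨t, h₁, h₂⟩ := exists_between (lt_min hlt' (hlt j))
      have ht := hpos j t h₁ (h₂.trans_le (min_le_right _ _)) e
      rw [hAB.mem_carrierAxes_of_mem_A hj he,
        h.profile_pos_iff_of_lost hX hy hL ((hnn _).trans h₁.le)] at ht
      exact (ht.1 (h₂.trans_le (min_le_left _ _))).false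
    · obtain ⟨i, rfl⟩ := Fin.exists_succ_eq.2 hj
      have hi : s i.castSucc.castSucc < s i.succ.castSucc := hlt i.castSucc
      obtain ⟨t, h₁, h₂⟩ := exists_between (max_lt hlt' hi)
      have ht := hpos i.castSucc t ((le_max_right _ _).trans_lt h₁) h₂ e
      rw [hAB.mem_carrierAxes_of_mem_A hj he, h.profile_pos_iff_of_lost hX hy hL
        ((hnn _).trans ((le_max_right _ _).trans h₁.le))] at ht
      exact (ht.2 Fin.castSucc_lt_succ).not_gt ((le_max_left _ _).trans_lt h₁)
  · have hG := hGB j hj e he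
    refine le_antisymm (le_of_not_gt fun hlt' => ?_) (le_of_not_gt fun hlt' => ?_)
    · obtain ⟨t, h₁, h₂⟩ := exists_between (lt_min hlt' (hlt j))
      have ht := hpos j t h₁ (h₂.trans_le (min_le_right _ _)) e
      rw [hAB.mem_carrierAxes_of_mem_B hj he, h.profile_pos_iff_of_gained hX hx hy hG
        ((h₂.le.trans (min_le_right _ _)).trans (hle1 _))] at ht
      exact (ht.2 le_rfl).not_gt (h₂.trans_le (min_le_left _ _))
    · obtain ⟨i, rfl⟩ := Fin.exists_succ_eq.2 hj
      have hi : s i.castSucc.castSucc < s i.succ.castSucc := hlt i.castSucc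
      obtain ⟨t, h₁, h₂⟩ := exists_between (max_lt hlt' hi)
      have ht := hpos i.castSucc t ((le_max_right _ _).trans_lt h₁) h₂ e
      rw [hAB.mem_carrierAxes_of_mem_B hj he, h.profile_pos_iff_of_gained hX hx hy hG
        (h₂.le.trans (hle1 _))] at ht
      exact (ht.1 ((le_max_left _ _).trans_lt h₁)).not_gt Fin.castSucc_lt_succ
  · have hl : 0 < r e := (h.nonneg e).trans_lt (h.lt e)
    obtain ⟨t, ht0, htr, ht⟩ := hfirst e (r e) hl
    rw [h.profile_pos_iff_of_lost hX hy he ht0.le, mem_carrierAxes] at ht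
    rcases ht.1 htr with hA | ⟨j, ⟨hj, hj'⟩, -⟩ | ⟨j, hj, hA⟩
    · rw [hAB.A_zero, mem_commonAxes_iff hX hx hy] at hA
      exact absurd he hA.2.1
    · exact absurd hj hj'.not_gt
    · exact ⟨j, hj.ne', hA⟩
  · have hl : l e < 1 := (h.lt e).trans_le (h.le_one e)
    obtain ⟨t, htl, ht1, ht⟩ := hlast e (l e) hl
    rw [h.profile_pos_iff_of_gained hX hx hy he ht1.le, mem_carrierAxes] at ht
    rcases ht.1 htl with hA | ⟨j, ⟨hj, -⟩, hB⟩ | ⟨j, hj, -⟩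
    · rw [hAB.A_zero, mem_commonAxes_iff hX hx hy] at hA
      exact absurd he hA.2.2
    · exact ⟨j, hj.ne', hB⟩
    · exact absurd hj (Fin.le_last j).not_gt

lemma norm_proj_sq (E : Finset (Fin M)) (z : Space M) : ‖proj E z‖ ^ 2 = ∑ e ∈ E, z e ^ 2 := by
  rw [EuclideanSpace.norm_sq_eq, ← Finset.sum_coe_sort E]
  simp [proj]

/-- A critical point of `s ↦ a² / s + b² / (1 - s)` balances `a` and `b`. -/
lemma mul_one_sub_eq_of_isLocalMin {a b τ : ℝ} (ha : 0 ≤ a) (hb : 0 ≤ b) (h0 : 0 < τ) (h1 : τ < 1)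
    (h : IsLocalMin (fun s => a ^ 2 / s + b ^ 2 / (1 - s)) τ) : a * (1 - τ) = b * τ := by
  have h1' : 1 - τ ≠ 0 := (sub_pos.2 h1).ne'
  have hd : HasDerivAt (fun s => a ^ 2 / s + b ^ 2 / (1 - s))
      ((0 * τ - a ^ 2 * 1) / τ ^ 2 + (0 * (1 - τ) - b ^ 2 * (-1)) / (1 - τ) ^ 2) τ :=
    ((hasDerivAt_const τ (a ^ 2)).div (hasDerivAt_id τ) h0.ne').add
      ((hasDerivAt_const τ (b ^ 2)).div ((hasDerivAt_id τ).const_sub 1) h1')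
  have := h.hasDerivAt_eq_zero hd
  field_simp at this
  refine (sq_eq_sq₀ (mul_nonneg ha (sub_pos.2 h1).le) (mul_nonneg hb h0.le)).1 ?_
  linarith

open Classical in
/-- The change of energy when the axes in `E` and `F` are lost and gained at another time. -/
lemma profileEnergy_update {E F : Finset (Fin M)} {τ s : ℝ} (hEF : Disjoint E F)
    (hE : ∀ e ∈ E, l e = 0 ∧ r e = τ ∧ y e = 0) (hF : ∀ e ∈ F, l e = τ ∧ r e = 1 ∧ x e = 0) :
    profileEnergy x y (fun e => if e ∈ F then s else l e) (fun e => if e ∈ E then s else r e) =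
      profileEnergy x y l r + (‖proj E x‖ ^ 2 / s + ‖proj F y‖ ^ 2 / (1 - s)) -
        (‖proj E x‖ ^ 2 / τ + ‖proj F y‖ ^ 2 / (1 - τ)) := by
  have hsum : ∀ (G : Finset (Fin M)) (z : Space M) (c : ℝ),
      ‖proj G z‖ ^ 2 / c = ∑ e, if e ∈ G then z e ^ 2 / c else 0 := by
    intro G z c
    rw [norm_proj_sq, Finset.sum_div, Finset.sum_ite_mem, Finset.univ_inter]
  rw [hsum, hsum, hsum, hsum, profileEnergy, profileEnergy, ← Finset.sum_add_distrib,
    ← Finset.sum_add_distrib, ← Finset.sum_add_distrib, ← Finset.sum_sub_distrib]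
  refine Finset.sum_congr rfl fun e _ => ?_
  by_cases heE : e ∈ E
  · have heF := Finset.disjoint_left.1 hEF heE
    obtain ⟨hl, hr, hy⟩ := hE e heE
    simp [heE, heF, hl, hr, hy]
  · by_cases heF : e ∈ F
    · obtain ⟨hl, hr, hx⟩ := hF e heF
      simp [heE, heF, hl, hr, hx]
    · simp [heE, heF]

lemma place_apply (E : Finset (Fin M)) (w : EuclideanSpace ℝ E) (e : Fin M) :
    place E w e = if h : e ∈ E then w ⟨e, h⟩ else 0 := rfl

/-- The time at which the axes of `A j` are exchanged for those of `B j`, as determined by the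
minimality of the energy. -/
lemma IsSupport.norm_proj_balance (hAB : IsSupport X x y γ A B) (hγ : IsGeodesic X x y γ)
    (hX : IsOrthantSpace m X) (hx : x ∈ X) (hy : y ∈ X) (h : IsSchedule X x y γ l r)
    {s : Fin (k + 2) → ℝ} (hs : StrictMono s) (hs0 : s 0 = 0) (hs1 : s (Fin.last (k + 1)) = 1)
    (hA : ∀ j ≠ 0, ∀ e ∈ A j, Lost X x y e ∧ r e = s j.castSucc)
    (hB : ∀ j ≠ 0, ∀ e ∈ B j, Gained X x y e ∧ l e = s j.castSucc)
    (hLA : ∀ e, Lost X x y e → ∃ j ≠ 0, e ∈ A j) (hGB : ∀ e, Gained X x y e → ∃ j ≠ 0, e ∈ B j)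
    (i : Fin k) :
    ‖proj (A i.succ) x‖ * (1 - s i.succ.castSucc) = ‖proj (B i.succ) y‖ * s i.succ.castSucc := by
  classical
  set τ := s i.succ.castSucc with hτ
  have hi0 : i.succ ≠ 0 := Fin.succ_ne_zero i
  have hprev : s i.castSucc.castSucc < τ := hs (by simp [Fin.lt_def])
  have hnext : τ < s i.succ.succ := hs Fin.castSucc_lt_succ
  have hprev0 : 0 ≤ s i.castSucc.castSucc := hs0.symm.trans_le (hs.monotone (Fin.zero_le _))
  have hnext1 : s i.succ.succ ≤ 1 := (hs.monotone (Fin.le_last _)).trans_eq hs1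
  refine mul_one_sub_eq_of_isLocalMin (norm_nonneg _) (norm_nonneg _) (hprev0.trans_lt hprev)
    (hnext.trans_le hnext1) ?_
  -- The exchange time moves only between its neighbours, so the order of the exchanges is
  -- unchanged.
  filter_upwards [Ioo_mem_nhds hprev hnext] with t ht
  have hE : ∀ e ∈ A i.succ, l e = 0 ∧ r e = τ ∧ y e = 0 := fun e he => by
    obtain ⟨hL, hr⟩ := hA _ hi0 e he
    exact ⟨h.left_eq_zero e (hL.not_gained hX hy), hr, hL.target_eq_zero hX hy⟩
  have hF : ∀ e ∈ B i.succ, l e = τ ∧ r e = 1 ∧ x e = 0 := fun e he => by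
    obtain ⟨hG, hl⟩ := hB _ hi0 e he
    exact ⟨hl, h.right_eq_one e fun hL => hL.not_gained hX hy hG, hG.source_eq_zero hX hx⟩
  have ht0 : 0 < t := hprev0.trans_lt ht.1
  have ht1 : t < 1 := ht.2.trans_le hnext1
  have hdisj := hAB.disjoint_AB _ _ hi0 hi0
  have hadm : Admissible X x y (fun e => if e ∈ B i.succ then t else l e)
      (fun e => if e ∈ A i.succ then t else r e) := by
    constructor
    · intro e
      split_ifs
      exacts [ht0.le, h.nonneg e]
    · intro e
      by_cases heA : e ∈ A i.succ
      · have heB := Finset.disjoint_left.1 hdisj heA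
        simpa [heA, heB, (hE e heA).1] using ht0
      · by_cases heB : e ∈ B i.succ
        · simpa [heA, heB, (hF e heB).2.1] using ht1
        · simpa [heA, heB] using h.lt e
    · intro e
      split_ifs
      exacts [ht1.le, h.le_one e]
    · intro e f he hf hef
      have hsep := h.sep e f he hf hef
      by_cases heA : e ∈ A i.succ <;> by_cases hfB : f ∈ B i.succ <;>
        simp only [heA, hfB, if_true, if_false, le_rfl]
      -- Here `f` is gained in a different exchange from that of `e`, hence strictly later and not
      -- before the upper neighbour of `τ`. The next case is its mirror image.
      · obtain ⟨j, hj0, hj⟩ := hGB f ⟨hf, e, he, hef⟩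
        have hl := (hB j hj0 f hj).2
        rw [(hE e heA).2.1, hl, hτ, hs.le_iff_le, Fin.castSucc_le_castSucc_iff] at hsep
        have hne : i.succ ≠ j := by
          rintro rfl
          exact hfB hj
        rw [hl]
        refine ht.2.le.trans (hs.monotone ?_)
        rw [Fin.succ_le_castSucc_iff]
        exact hsep.lt_of_ne hne
      · obtain ⟨j, hj0, hj⟩ := hLA e ⟨he, f, hf, hef⟩
        have hr := (hA j hj0 e hj).2
        rw [(hF f hfB).1, hr, hτ, hs.le_iff_le, Fin.castSucc_le_castSucc_iff] at hsep
        have hne : j ≠ i.succ := by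
          rintro rfl
          exact heA hj
        rw [hr]
        refine (hs.monotone ?_).trans ht.1.le
        rw [Fin.castSucc_le_castSucc_iff, Fin.le_castSucc_iff]
        exact hsep.lt_of_ne hne
      · exact hsep
  have hlow := hX.sq_intrinsicDist_le hx hy hadm
  have hup := (hγ.eq_profile hX hx hy h).1
  rw [profileEnergy_update hdisj hE hF] at hlow
  linarith

end Orthant

/-! ### The formula for the translated logarithm. -/

theorem theorem1 {M m : ℕ} (X : Set (Orthant.Space M)) (hX : Orthant.IsOrthantSpace m X)
    (xstar x : Orthant.Space M) (hxstar : xstar ∈ X) (hx : x ∈ X)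
    (γ : ℝ → Orthant.Space M) (hγ : Orthant.IsGeodesic X xstar x γ)
    (k : ℕ) (A B : Fin (k + 1) → Finset (Fin M)) (hAB : Orthant.IsSupport X xstar x γ A B) :
    (HasDerivWithinAt γ (Orthant.logMap X xstar x) (Set.Icc 0 1) 0 ∧
      ‖Orthant.logMap X xstar x‖ = Orthant.intrinsicDist X xstar x) ∧
    (∀ i : Fin k, ‖Orthant.proj (A i.succ) xstar‖ ≠ 0) ∧
    Orthant.translatedLog X x xstar =
      Orthant.jmath (B 0) (fun i : Fin k => A i.succ)
        (Orthant.proj (B 0) x)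
        (fun i : Fin k =>
          -(‖Orthant.proj (B i.succ) x‖ / ‖Orthant.proj (A i.succ) xstar‖) •
            Orthant.proj (A i.succ) xstar) := by
  open Orthant in
  obtain ⟨l, r, h⟩ := hγ.exists_isSchedule hX hxstar hx
  obtain ⟨s, hs, hs0, hs1, hA, hB, hLA, hGB⟩ := hAB.exists_times hγ hX hxstar hx h
  have hbal := hAB.norm_proj_balance hγ hX hxstar hx h hs hs0 hs1 hA hB hLA hGB
  have hlog := hγ.logMap_eq hX hxstar hx h
  have hτ0 : ∀ i : Fin k, 0 < s i.succ.castSucc := fun i => by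
    rw [← hs0]
    exact hs (Fin.lt_def.2 (by simp))
  have hne : ∀ i : Fin k, ‖proj (A i.succ) xstar‖ ≠ 0 := by
    intro i hi
    have hb := hbal i
    rw [hi, zero_mul, eq_comm, mul_eq_zero, or_iff_left (hτ0 i).ne'] at hb
    have hempty : ∀ (E : Finset (Fin M)) (z : Space M), ‖proj E z‖ = 0 → (∀ e ∈ E, 0 < z e) →
        E = ∅ := by
      intro E z hz hpos
      by_contra hE
      have := Finset.sum_pos (fun e he => pow_pos (hpos e he) 2) (Finset.nonempty_iff_ne_empty.2 hE)
      rw [← norm_proj_sq, hz] at this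
      norm_num at this
    have hA0 := hempty _ _ hi fun e he => (hA _ (Fin.succ_ne_zero i) e he).1.1
    have hB0 := hempty _ _ hb fun e he => (hB _ (Fin.succ_ne_zero i) e he).1.1
    -- By the balance equation `A i.succ` and `B i.succ` would both be empty, so two consecutive
    -- strata of the carrier would coincide.
    refine hAB.carrier.2 i ?_
    ext e
    rw [mem_carrierAxes, mem_carrierAxes]
    refine or_congr_right (or_congr ⟨?_, ?_⟩ ⟨?_, ?_⟩)
    · rintro ⟨j, ⟨hj, hj'⟩, he⟩
      exact ⟨j, ⟨hj, hj'.trans Fin.castSucc_lt_succ.le⟩, he⟩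
    · rintro ⟨j, ⟨hj, hj'⟩, he⟩
      refine ⟨j, ⟨hj, Fin.le_castSucc_iff.2 (hj'.lt_of_ne ?_)⟩, he⟩
      rintro rfl
      simp [hB0] at he
    · rintro ⟨j, hj, he⟩
      refine ⟨j, (Fin.castSucc_lt_iff_succ_le.1 hj).lt_of_ne ?_, he⟩
      rintro rfl
      simp [hA0] at he
    · rintro ⟨j, hj, he⟩
      exact ⟨j, Fin.castSucc_lt_succ.trans hj, he⟩
  refine ⟨hlog ▸ hγ.hasDerivWithinAt hX hxstar hx h, hne, ?_⟩
  have hcommon : ∀ e, e ∈ B 0 ↔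
      (0 < xstar e ∨ 0 < x e) ∧ ¬ Lost X xstar x e ∧ ¬ Gained X xstar x e := fun e => by
    rw [hAB.B_zero]
    exact mem_commonAxes_iff hX hxstar hx
  have hsum0 : ∀ e, ¬ Lost X xstar x e → ∀ w : ∀ i : Fin k, EuclideanSpace ℝ (A i.succ),
      ∑ i, place (A i.succ) (w i) e = 0 := fun e he w => by
    refine Finset.sum_eq_zero fun i _ => ?_
    rw [place_apply, dif_neg fun hmem => he (hA _ (Fin.succ_ne_zero i) e hmem).1]
  ext e
  rw [translatedLog, hlog, jmath, PiLp.add_apply, PiLp.add_apply, WithLp.ofLp_sum,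
    Finset.sum_apply, place_apply]
  simp only [profileVelocity]
  by_cases hL : Lost X xstar x e
  · have hl : l e = 0 := h.left_eq_zero e (hL.not_gained hX hx)
    obtain ⟨j, hj0, hj⟩ := hLA e hL
    obtain ⟨i, rfl⟩ := Fin.exists_succ_eq.2 hj0
    rw [dif_neg (fun hm => ((hcommon e).1 hm).2.1 hL), zero_add, if_pos hl,
      hL.target_eq_zero hX hx, (hA _ hj0 e hj).2, Finset.sum_eq_single i]
    · rw [place_apply, dif_pos hj]
      change (0 - xstar e) / s i.succ.castSucc + xstar e =
        -(‖proj (B i.succ) x‖ / ‖proj (A i.succ) xstar‖) * xstar e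
      have ha := hne i
      have hτ := (hτ0 i).ne'
      have hb := hbal i
      field_simp
      linear_combination (-xstar e) * hb
    · intro i' _ hi'
      rw [place_apply, dif_neg]
      exact Finset.disjoint_left.1
        (hAB.disjoint_A _ _ fun heq => hi' (Fin.succ_injective _ heq).symm) hj
    · simp
  · rw [hsum0 e hL, add_zero]
    by_cases hG : Gained X xstar x e
    · rw [dif_neg (fun hm => ((hcommon e).1 hm).2.2 hG),
        if_neg (h.toAdmissible.left_pos_of_gained hG).ne', hG.source_eq_zero hX hxstar, add_zero]
    -- A coordinate neither lost nor gained moves over all of `[0, 1]`, so translation returns the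
    -- target coordinate; outside `B 0` this is zero.
    · rw [if_pos (h.left_eq_zero e hG), h.right_eq_one e hL, div_one, sub_add_cancel]
      split_ifs with hm
      · rfl
      · have := (hcommon e).not.1 hm
        have hxe : ¬ 0 < x e := by tauto
        exact le_antisymm (not_lt.1 hxe) (hX.nonneg hx e)
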